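/- Let $n\ge 2$ and let $\mathbf a=(a_0,\dots,a_n)$ be integers with all $a_j\ge 2$. Put $d=\operatorname{lcm}(a_0,\dots,a_n)$, $w_j=d/a_j$ and $f_{\mathbf a}(\mathbf z)=z_0^{a_0}+\cdots+z_n^{a_n}$. The Brieskorn manifold is $M_{\mathbf a}=\{f_{\mathbf a}=0\}\cap S^{2n+1}\subset\mathbb C^{n+1}$, of real dimension $2n-1$; the Reeb flow of its natural Sasakian structure is the weighted circle action $t\cdot\mathbf z=(e^{iw_0t}z_0,\dots,e^{iw_nt}z_n)$, and its quotient is $V_{\mathbf a}=(\{f_{\mathbf a}=0\}\setminus\{0\})/\mathbb C^*$, where $\lambda\in\mathbb C^*$ acts by $\lambda\cdot\mathbf z=(\lambda^{w_0}z_0,\dots,\lambda^{w_n}z_n)$. The Sasakian structure is called *regular* if every point of $M_{\mathbf a}$ has a foliated neighbourhood (flow box) through which each Reeb orbit passes at most once, and *positive* if $V_{\mathbf a}$ is Fano, i.e. the anticanonical bundle of $V_{\mathbf a}$ (defined through local holomorphic transversals to the $\mathbb C^*$-orbits) admits a smooth Hermitian metric of positive curvature. Then the Brieskorn manifolds $M_{\mathbf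 a}$ of dimension $5$ and $7$ (with all $a_j\ge2$) whose natural Sasakian structure is regular and positive are exactly those for which, up to a permutation of the entries, 1. if $n=3$: $\mathbf a$ is one of $(2,2,2,2)$, $(3,3,3,3)$, $(4,4,4,2)$, $(6,6,3,2)$; 2. if $n=4$: $\mathbf a$ is one of $(2,2,2,2,2)$, $(3,3,3,3,3)$, $(4,4,4,4,4)$, $(4,4,4,4,2)$, $(6,6,6,6,2)$, $(6,6,6,3,2)$. -/

import Mathlib

open scoped ContDiff

noncomputable section

namespace Brieskorn

/-- The degree `d = lcm (a₀, …, aₙ)` of the Brieskorn–Pham polynomial with exponents `a`. -/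
def degree {N : ℕ} (a : Fin N → ℕ) : ℕ := Finset.univ.lcm a

/-- The weights `wⱼ = d / aⱼ`. -/
def weight {N : ℕ} (a : Fin N → ℕ) (j : Fin N) : ℕ := degree a / a j

/-- The Brieskorn–Pham polynomial `f_a(z) = ∑ zⱼ ^ aⱼ`. -/
def poly {N : ℕ} (a : Fin N → ℕ) (z : Fin N → ℂ) : ℂ := ∑ j, z j ^ a j

/-- The weighted action `c · z = (c ^ w₀ z₀, …, c ^ wₙ zₙ)`. -/
def act {N : ℕ} (a : Fin N → ℕ) (c : ℂ) (z : Fin N → ℂ) : Fin N → ℂ :=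
  fun j => c ^ weight a j * z j

/-- The punctured affine cone `Y_a = {f_a = 0} \ {0}`. -/
def cone {N : ℕ} (a : Fin N → ℕ) : Set (Fin N → ℂ) := {z | poly a z = 0 ∧ z ≠ 0}

/-- The Brieskorn manifold `M_a = {f_a = 0} ∩ S`, with `S` the Euclidean unit sphere. -/
def link {N : ℕ} (a : Fin N → ℕ) : Set (Fin N → ℂ) :=
  {z | poly a z = 0 ∧ ∑ j, ‖z j‖ ^ 2 = 1}

theorem weight_mul {N : ℕ} (a : Fin N → ℕ) (j : Fin N) : weight a j * a j = degree a :=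
  Nat.div_mul_cancel (Finset.dvd_lcm (Finset.mem_univ j))

theorem poly_act {N : ℕ} (a : Fin N → ℕ) (c : ℂ) (z : Fin N → ℂ) :
    poly a (act a c z) = c ^ degree a * poly a z := by
  simp only [poly, act, Finset.mul_sum, mul_pow, ← pow_mul, weight_mul]

theorem act_mem_link {N : ℕ} (a : Fin N → ℕ) (t : ℝ) {z : Fin N → ℂ} (hz : z ∈ link a) :
    act a (Complex.exp (t * Complex.I)) z ∈ link a := by
  refine ⟨by rw [poly_act, hz.1, mul_zero], ?_⟩
  simpa [act, Complex.norm_exp_ofReal_mul_I] using hz.2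

/-- The flow on `M_a` of the Reeb vector field of its natural Sasakian structure, that is, the
weighted circle action `t ↦ (e^{i w₀ t} z₀, …, e^{i wₙ t} zₙ)`. -/
def reebFlow {N : ℕ} (a : Fin N → ℕ) (t : ℝ) (z : link a) : link a :=
  ⟨act a (Complex.exp (t * Complex.I)) z.1, act_mem_link a t z.2⟩

/-- Regularity of the Reeb foliation: every point has a foliated neighbourhood
`U ≅ T × (-ε, ε)` (a flow box over a local transversal `T`) through which each leaf, i.e. each
orbit of the Reeb flow, passes at most once. -/
def IsRegular {N : ℕ} (a : Fin N → ℕ) : Prop :=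
  ∀ p : link a, ∃ (T : Set (link a)) (ε : ℝ), 0 < ε ∧ p ∈ T ∧
    Topology.IsOpenEmbedding
      (fun q : T × Set.Ioo (-ε) ε => reebFlow a (q.2 : ℝ) (q.1 : link a)) ∧
    ∀ x ∈ T, ∀ y ∈ T, (∃ t : ℝ, reebFlow a t x = y) → x = y

/-- The holomorphic vector field `(w₀ z₀, …, wₙ zₙ)` generating the weighted `ℂˣ`-action. -/
def euler {N : ℕ} (a : Fin N → ℕ) (z : Fin N → ℂ) : Fin N → ℂ :=
  fun j => (weight a j : ℂ) * z j

/-- The pairs `(y, v)` of a point `y` of the cone and an `m`-tuple `v` of holomorphic tangent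
vectors of the cone at `y`. -/
def tangentTuples {m : ℕ} (a : Fin (m + 2) → ℕ) :
    Set ((Fin (m + 2) → ℂ) × (Fin m → Fin (m + 2) → ℂ)) :=
  {p | p.1 ∈ cone a ∧ ∀ i, fderiv ℂ (poly a) p.1 (p.2 i) = 0}

/-- A smooth Hermitian metric on the anticanonical bundle `Λᵐ T V_a` of the `m`-dimensional
quotient `V_a = Y_a / ℂˣ`. As `T V_a` at the class of `y` is `T_y Y_a / ℂ · euler y`, it is given by
the function sending `y` and `v₁, …, v_m ∈ T_y Y_a` to the squared norm of `[v₁] ∧ ⋯ ∧ [v_m]`. -/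
structure AnticanonicalMetric {m : ℕ} (a : Fin (m + 2) → ℕ) where
  normSq : (Fin (m + 2) → ℂ) → (Fin m → Fin (m + 2) → ℂ) → ℝ
  smooth : ContDiffOn ℝ ∞ (fun p => normSq p.1 p.2) (tangentTuples a)
  pos : ∀ y v, (y, v) ∈ tangentTuples a →
    LinearIndependent ℂ (Fin.cons (euler a y) v : Fin (m + 1) → Fin (m + 2) → ℂ) →
    0 < normSq y v
  map_det : ∀ y v, (y, v) ∈ tangentTuples a → ∀ A : Matrix (Fin m) (Fin m) ℂ,
    normSq y (fun i => ∑ k, A i k • v k) = ‖A.det‖ ^ 2 * normSq y v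
  add_euler : ∀ y v, (y, v) ∈ tangentTuples a → ∀ c : Fin m → ℂ,
    normSq y (fun i => v i + c i • euler a y) = normSq y v
  map_act : ∀ y v, (y, v) ∈ tangentTuples a → ∀ c : ℂ, c ≠ 0 →
    normSq (act a c y) (fun i => act a c (v i)) = normSq y v

/-- A local holomorphic chart of `V_a`, given by a holomorphic map `σ` from an open set `D ⊆ ℂᵐ`
to the cone that is an immersion transverse to the `ℂˣ`-orbits. -/
def IsTransversal {m : ℕ} (a : Fin (m + 2) → ℕ) (D : Set (Fin m → ℂ))
    (σ : (Fin m → ℂ) → (Fin (m + 2) → ℂ)) : Prop :=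
  IsOpen D ∧ DifferentiableOn ℂ σ D ∧ ∀ x ∈ D, σ x ∈ cone a ∧
    LinearIndependent ℂ
      (Fin.cons (euler a (σ x)) (fun i => fderiv ℂ σ x (Pi.single i 1)) :
        Fin (m + 1) → Fin (m + 2) → ℂ)

/-- The Levi form `4 ∑ (∂²φ / ∂xᵢ ∂x̄ₖ) ξᵢ ξ̄ₖ` of a real function on `ℂᵐ`. -/
def leviForm {m : ℕ} (φ : (Fin m → ℂ) → ℝ) (x ξ : Fin m → ℂ) : ℝ :=
  iteratedFDeriv ℝ 2 φ x ![ξ, ξ] +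
    iteratedFDeriv ℝ 2 φ x ![Complex.I • ξ, Complex.I • ξ]

/-- Positivity of the natural Sasakian structure: the quotient `V_a` is Fano, i.e. its anticanonical
bundle has a Hermitian metric whose curvature `-i∂∂̄ log ‖∂₁ ∧ ⋯ ∧ ∂_m‖²` is positive definite
in every chart. -/
def IsPositive {m : ℕ} (a : Fin (m + 2) → ℕ) : Prop :=
  ∃ h : AnticanonicalMetric a, ∀ D σ, IsTransversal a D σ → ∀ x ∈ D, ∀ ξ : Fin m → ℂ, ξ ≠ 0 →
    0 < leviForm
      (fun x' => -Real.log (h.normSq (σ x') (fun i => fderiv ℂ σ x' (Pi.single i 1)))) x ξ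

end Brieskorn

end

/-! Let `|w|` be the sum of the weights and `d` the degree. The geometry reduces to arithmetic:
regularity means that the weights are pairwise coprime, and positivity together with regularity adds
exactly the condition `d < |w|`. A short search on sorted weights then gives the lists.

Regularity. Where `z_i` and `z_k` are nonzero and the weights `w_i`, `w_k` are coprime, Bézout
exponents turn the angular parts of these coordinates into a circle-valued function of weight one,
whose level sets are global slices (`isRegular_of_coprime`). Conversely, if `g = gcd(w_i, w_k) > 1`,
a point supported on these two coordinates is fixed by the `g`-th roots of unity, while arbitrarily
close points have trivial isotropy, so their orbits return to any small flow box
(`coprime_of_isRegular`).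

Positivity. The residue of `dz₀ ∧ ⋯ ∧ dz_{m+1} / f`, contracted with the Euler field, trivialises
the canonical bundle up to the weight `|w| - d`. If `d < |w|`, dividing its squared modulus by a
positive power of a sum of squared monomials gives an invariant metric of Fubini–Study type.
Coprimality supplies enough monomials to separate tangent directions, so the curvature is strictly
positive (`isPositive_of_coprime`). If `|w| ≤ d`, the residue times a power of `z₀` has weight zero.
Its norm in any anticanonical metric attains a maximum by compactness, and there the curvature
cannot be positive, its logarithm being the metric potential plus pluriharmonic terms
(`degree_lt_of_isPositive`). -/

open scoped ContDiff

noncomputable section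

namespace Brieskorn

/-! ### Smoothness of holomorphic maps in several variables. -/

section Osgood

open Metric MeasureTheory Topology

variable {E F : Type*} [NormedAddCommGroup E] [NormedSpace ℂ E]
  [FiniteDimensional ℂ E] [NormedAddCommGroup F] [NormedSpace ℂ F] [FiniteDimensional ℂ F]

/-- Directional derivatives of a holomorphic map are holomorphic. -/
theorem differentiableOn_fderiv_apply {f : E → F} {D : Set E} (hD : IsOpen D)
    (hf : DifferentiableOn ℂ f D) (v : E) :
    DifferentiableOn ℂ (fun x => fderiv ℂ f x v) D := by
  intro x₀ hx₀
  have : ProperSpace E := FiniteDimensional.proper ℂ E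
  have : ProperSpace F := FiniteDimensional.proper ℂ F
  have : ProperSpace (E →L[ℂ] F) := FiniteDimensional.proper ℂ _
  have : SecondCountableTopology (E →L[ℂ] F) := inferInstance
  let : NormedSpace ℝ F := NormedSpace.restrictScalars ℝ ℂ F
  borelize E
  borelize F
  borelize (E →L[ℂ] F)
  obtain ⟨R, hR, hRD⟩ := nhds_basis_closedBall.mem_iff.1 (hD.mem_nhds hx₀)
  obtain ⟨C, hC⟩ := (isCompact_closedBall x₀ R).exists_bound_of_continuousOn
    (hf.continuousOn.mono hRD)
  -- A quarter of `R` leaves room twice: the Cauchy circles about points of `ball x₀ r` stay in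
  -- `ball x₀ (2 * r)`, and balls of radius `2 * r` about those points, used for the derivative
  -- estimate, stay in `closedBall x₀ R`.
  set r : ℝ := R / 4 with hr
  have hr0 : 0 < r := by positivity
  have hC0 : 0 ≤ C := (norm_nonneg _).trans (hC x₀ (mem_closedBall_self hR.le))
  have hbd : ∀ x ∈ ball x₀ (2 * r), ‖fderiv ℂ f x‖ ≤ (2 * C) / (2 * r) := fun x hx => by
    have hsub : ball x (2 * r) ⊆ closedBall x₀ R := fun y hy => by
      rw [mem_closedBall]
      have := dist_triangle y x x₀
      rw [mem_ball] at hx hy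
      linarith
    refine Complex.norm_fderiv_le_div_of_mapsTo_ball (hf.mono (hsub.trans hRD)) (fun y hy => ?_)
      (by positivity)
    rw [mem_closedBall, dist_eq_norm]
    have h1 := norm_sub_le (f y) (f x)
    have h2 := hC y (hsub hy)
    have h3 := hC x (hsub (mem_ball_self (by positivity)))
    linarith
  set ρ : ℝ := r / (‖v‖ + 1) with hρ
  have hρ0 : 0 < ρ := by positivity
  have hρv : ρ * ‖v‖ < r := by
    rw [hρ, div_mul_eq_mul_div, div_lt_iff₀ (by positivity)]
    nlinarith [norm_nonneg v]
  have hmem : ∀ x ∈ ball x₀ r, ∀ t : ℂ, ‖t‖ ≤ ρ → x + t • v ∈ ball x₀ (2 * r) := by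
    intro x hx t ht
    rw [mem_ball, dist_eq_norm] at hx ⊢
    calc ‖x + t • v - x₀‖ = ‖(x - x₀) + t • v‖ := by congr 1; abel
      _ ≤ ‖x - x₀‖ + ‖t‖ * ‖v‖ := (norm_add_le _ _).trans (by rw [norm_smul])
      _ < 2 * r := by nlinarith [norm_nonneg v, mul_le_mul_of_nonneg_right ht (norm_nonneg v)]
  have hsubD : ball x₀ (2 * r) ⊆ D := fun y hy => hRD (by
    rw [mem_closedBall]; rw [mem_ball] at hy; linarith)
  have hfd : ∀ y ∈ ball x₀ (2 * r), HasFDerivAt f (fderiv ℂ f y) y := fun y hy =>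
    (hf.differentiableAt (hD.mem_nhds (hsubD hy))).hasFDerivAt
  have hcirc : ∀ θ : ℝ, ‖circleMap 0 ρ θ‖ ≤ ρ := fun θ => by simp [abs_of_pos hρ0]
  let k : ℝ → ℂ := fun θ => deriv (circleMap 0 ρ) θ * (1 / (circleMap 0 ρ θ) ^ 2)
  have hk : Continuous k := by
    have : ∀ θ, circleMap 0 ρ θ ≠ 0 := fun θ => by simpa using hρ0.ne'
    simp only [k, deriv_circleMap]
    refine ((continuous_circleMap 0 ρ).mul continuous_const).mul
      (continuous_const.div ((continuous_circleMap 0 ρ).pow 2) fun θ => pow_ne_zero 2 (this θ))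
  -- Cauchy's formula on the complex line through `x` in direction `v` expresses the derivative
  -- through values of `f` alone, so the integral can be differentiated in `x`.
  have hcauchy : ∀ x ∈ ball x₀ r, fderiv ℂ f x v = (2 * Real.pi * Complex.I : ℂ)⁻¹ •
      ∫ θ in (0 : ℝ)..2 * Real.pi, k θ • f (x + circleMap 0 ρ θ • v) := by
    intro x hx
    have hd : ∀ t : ℂ, ‖t‖ ≤ ρ → HasDerivAt (fun t : ℂ => f (x + t • v))
        (fderiv ℂ f (x + t • v) v) t := fun t ht => by
      have h2 : HasDerivAt (fun t : ℂ => x + t • v) v t := by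
        simpa using ((hasDerivAt_id t).smul_const v).const_add x
      exact (hfd _ (hmem x hx t ht)).comp_hasDerivAt t h2
    have h := DifferentiableOn.deriv_eq_smul_circleIntegral (c := 0) (R := ρ)
      (f := fun t : ℂ => f (x + t • v)) hρ0
      (fun t ht => (hd t (by simpa using ht)).differentiableAt.differentiableWithinAt)
    rw [(hd 0 (by simpa using hρ0.le)).deriv] at h
    simp only [zero_smul, add_zero, sub_zero, circleIntegral] at h
    rw [eq_inv_smul_iff₀ Complex.two_pi_I_ne_zero, ← h]
    simp only [k, mul_smul]
  have hcont : ∀ x ∈ ball x₀ r, Continuous fun θ : ℝ => k θ • f (x + circleMap 0 ρ θ • v) := by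
    intro x hx
    refine hk.smul (ContinuousOn.comp_continuous (hf.continuousOn.mono hsubD) ?_
      fun θ => hmem x hx _ (hcirc θ))
    exact continuous_const.add ((continuous_circleMap 0 ρ).smul continuous_const)
  have key := intervalIntegral.hasFDerivAt_integral_of_dominated_of_fderiv_le (𝕜 := ℂ)
    (μ := volume) (a := 0) (b := 2 * Real.pi) (x₀ := x₀) (s := ball x₀ r)
    (F := fun x θ => k θ • f (x + circleMap 0 ρ θ • v))
    (F' := fun x θ => k θ • fderiv ℂ f (x + circleMap 0 ρ θ • v))
    (bound := fun θ => ‖k θ‖ * ((2 * C) / (2 * r)))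
    (ball_mem_nhds x₀ hr0)
    (Filter.eventually_of_mem (ball_mem_nhds x₀ hr0) fun x hx =>
      (hcont x hx).aestronglyMeasurable)
    ((hcont x₀ (mem_ball_self hr0)).intervalIntegrable _ _)
    (by
      refine AEStronglyMeasurable.smul hk.aestronglyMeasurable ?_
      refine Measurable.aestronglyMeasurable ?_
      -- Continuity of the derivative is not yet known here; measurability is automatic and suffices
      -- for dominated differentiation.
      exact (measurable_fderiv ℂ f).comp
        (continuous_const.add ((continuous_circleMap 0 ρ).smul continuous_const)).measurable)
    (Filter.Eventually.of_forall fun θ _ x hx => by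
      rw [norm_smul]
      exact mul_le_mul_of_nonneg_left (hbd _ (hmem x hx _ (hcirc θ))) (norm_nonneg _))
    ((hk.norm.mul continuous_const).intervalIntegrable _ _)
    (Filter.Eventually.of_forall fun θ _ x hx => by
      have h2 : HasFDerivAt (fun x : E => x + circleMap 0 ρ θ • v) (ContinuousLinearMap.id ℂ E) x :=
        (hasFDerivAt_id x).add_const _
      have h1 := (hfd _ (hmem x hx _ (hcirc θ))).comp x h2
      exact h1.const_smul (k θ))
  refine DifferentiableAt.differentiableWithinAt ?_
  refine DifferentiableAt.congr_of_eventuallyEq (key.differentiableAt.const_smul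
    ((2 * Real.pi * Complex.I : ℂ)⁻¹)) ?_
  exact Filter.eventually_of_mem (ball_mem_nhds x₀ hr0) hcauchy

/-- Holomorphic maps of several variables are smooth. -/
theorem contDiffOn_nat_of_differentiableOn {f : E → F} {D : Set E} (hD : IsOpen D)
    (hf : DifferentiableOn ℂ f D) (n : ℕ) : ContDiffOn ℂ n f D := by
  induction n generalizing f with
  | zero => exact contDiffOn_zero.2 hf.continuousOn
  | succ n ih =>
    push_cast
    rw [contDiffOn_succ_iff_fderiv_of_isOpen hD]
    exact ⟨hf, by simp, contDiffOn_clm_apply.2 fun v => ih (differentiableOn_fderiv_apply hD hf v)⟩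

end Osgood

/-! ### Second derivatives along lines and the Levi form. -/

section Levi

open Topology Filter ComplexConjugate

theorem eventually_hasDerivAt_line {E : Type*} [NormedAddCommGroup E] [NormedSpace ℝ E]
    {φ : E → ℝ} {x : E} (v : E) (hφ : ContDiffAt ℝ 2 φ x) :
    (∀ᶠ s in 𝓝 (0 : ℝ), HasDerivAt (fun s : ℝ => φ (x + s • v)) (fderiv ℝ φ (x + s • v) v) s) ∧
      HasDerivAt (fun s : ℝ => fderiv ℝ φ (x + s • v) v) (iteratedFDeriv ℝ 2 φ x ![v, v]) 0 := by
  have hl : ∀ s : ℝ, HasDerivAt (fun s : ℝ => x + s • v) v s := fun s => by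
    simpa using ((hasDerivAt_id s).smul_const v).const_add x
  have hc : Tendsto (fun s : ℝ => x + s • v) (𝓝 0) (𝓝 x) := by
    simpa using (hl 0).continuousAt.tendsto
  constructor
  · have h := hc.eventually (hφ.eventually (by simp))
    filter_upwards [h] with s hs
    exact (hs.differentiableAt (by norm_num)).hasFDerivAt.comp_hasDerivAt s (hl s)
  · rw [iteratedFDeriv_two_apply]
    have h1 : DifferentiableAt ℝ (fderiv ℝ φ) x :=
      (hφ.fderiv_right (m := 1) (by norm_num)).differentiableAt (by norm_num)
    have h2 : HasFDerivAt (fderiv ℝ φ) (fderiv ℝ (fderiv ℝ φ) x) (x + (0 : ℝ) • v) := by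
      simpa using h1.hasFDerivAt
    have h3 := h2.comp_hasDerivAt (0 : ℝ) (hl 0)
    simpa using (h3.clm_apply (hasDerivAt_const (0 : ℝ) v))

theorem iteratedFDeriv_two_eq_of_hasDerivAt {E : Type*} [NormedAddCommGroup E] [NormedSpace ℝ E]
    {φ : E → ℝ} {x v : E} (hφ : ContDiffAt ℝ 2 φ x) {g₁ : ℝ → ℝ} {g₂ : ℝ}
    (h₁ : ∀ᶠ s in 𝓝 (0 : ℝ), HasDerivAt (fun s : ℝ => φ (x + s • v)) (g₁ s) s)
    (h₂ : HasDerivAt g₁ g₂ 0) : iteratedFDeriv ℝ 2 φ x ![v, v] = g₂ := by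
  obtain ⟨h3, h4⟩ := eventually_hasDerivAt_line v hφ
  have : g₁ =ᶠ[𝓝 0] fun s : ℝ => fderiv ℝ φ (x + s • v) v := by
    filter_upwards [h₁, h3] with s a b using a.unique b
  exact h4.unique (h₂.congr_of_eventuallyEq this.symm)

/-- A positive second derivative along a line would make the point a local minimum there as well;
the restriction would then be locally constant, with second derivative zero. -/
theorem iteratedFDeriv_two_nonpos_of_isLocalMax {E : Type*} [NormedAddCommGroup E]
    [NormedSpace ℝ E] {φ : E → ℝ} {x : E} (hφ : ContDiffAt ℝ 2 φ x) (hmax : IsLocalMax φ x)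
    (v : E) : iteratedFDeriv ℝ 2 φ x ![v, v] ≤ 0 := by
  by_contra! hpos
  obtain ⟨h3, h4⟩ := eventually_hasDerivAt_line v hφ
  set g : ℝ → ℝ := fun s => φ (x + s • v) with hg
  have hd : deriv g =ᶠ[𝓝 0] fun s : ℝ => fderiv ℝ φ (x + s • v) v := by
    filter_upwards [h3] with s a using a.deriv
  have hdd : deriv (deriv g) 0 = iteratedFDeriv ℝ 2 φ x ![v, v] := by
    rw [hd.deriv_eq, h4.deriv]
  have hgc : ContinuousAt g 0 := h3.self_of_nhds.continuousAt
  have hgmax : IsLocalMax g 0 := by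
    have hc : Tendsto (fun s : ℝ => x + s • v) (𝓝 0) (𝓝 x) := by
      have : Continuous (fun s : ℝ => x + s • v) := by fun_prop
      simpa using this.tendsto 0
    have := hc.eventually hmax
    simpa [IsLocalMax, IsMaxFilter, hg] using this
  have hgmin := isLocalMin_of_deriv_deriv_pos (by rw [hdd]; exact hpos) hgmax.deriv_eq_zero hgc
  have hconst : g =ᶠ[𝓝 0] fun _ => g 0 := by
    filter_upwards [hgmax, hgmin] with s a b using le_antisymm a b
  have h0 : deriv g =ᶠ[𝓝 0] fun _ => 0 := by
    have := hconst.deriv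
    simpa using this
  rw [← hdd, h0.deriv_eq] at hpos
  simp at hpos

variable {m : ℕ}

theorem leviForm_congr {φ ψ : (Fin m → ℂ) → ℝ} {x : Fin m → ℂ} (h : φ =ᶠ[𝓝 x] ψ)
    (ξ : Fin m → ℂ) : leviForm φ x ξ = leviForm ψ x ξ := by
  simp only [leviForm, (h.iteratedFDeriv ℝ 2).self_of_nhds]

theorem leviForm_add {φ ψ : (Fin m → ℂ) → ℝ} {x : Fin m → ℂ} (hφ : ContDiffAt ℝ 2 φ x)
    (hψ : ContDiffAt ℝ 2 ψ x) (ξ : Fin m → ℂ) :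
    leviForm (fun x => φ x + ψ x) x ξ = leviForm φ x ξ + leviForm ψ x ξ := by
  have : iteratedFDeriv ℝ 2 (fun x => φ x + ψ x) x
      = iteratedFDeriv ℝ 2 φ x + iteratedFDeriv ℝ 2 ψ x := iteratedFDeriv_add_apply hφ hψ
  simp only [leviForm, this, _root_.add_apply]
  ring

theorem leviForm_const_mul {φ : (Fin m → ℂ) → ℝ} {x : Fin m → ℂ} (hφ : ContDiffAt ℝ 2 φ x)
    (c : ℝ) (ξ : Fin m → ℂ) : leviForm (fun x => c * φ x) x ξ = c * leviForm φ x ξ := by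
  have : iteratedFDeriv ℝ 2 (c • φ) x = c • iteratedFDeriv ℝ 2 φ x :=
    iteratedFDeriv_const_smul_apply hφ
  change leviForm (c • φ) x ξ = _
  simp only [leviForm, this, _root_.smul_apply, smul_eq_mul]
  ring

theorem leviForm_nonpos_of_isLocalMax {φ : (Fin m → ℂ) → ℝ} {x : Fin m → ℂ}
    (hφ : ContDiffAt ℝ 2 φ x) (hmax : IsLocalMax φ x) (ξ : Fin m → ℂ) : leviForm φ x ξ ≤ 0 :=
  add_nonpos (iteratedFDeriv_two_nonpos_of_isLocalMax hφ hmax _)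
    (iteratedFDeriv_two_nonpos_of_isLocalMax hφ hmax _)

theorem contDiffAt_sum_norm_sq {κ : Type*} {s : Finset κ} {g : κ → (Fin m → ℂ) → ℂ}
    {x : Fin m → ℂ} (hg : ∀ k ∈ s, ContDiffAt ℂ 2 (g k) x) :
    ContDiffAt ℝ 2 (fun x => ∑ k ∈ s, ‖g k x‖ ^ 2) x :=
  ContDiffAt.sum fun k hk => ((hg k hk).restrict_scalars ℝ).norm_sq ℝ

/-- Pythagoras for the orthogonal projection of `A` onto the line of `u`. It presents the
Cauchy–Schwarz defect as a sum of squares, so that the equality case can be read off. -/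
theorem sum_norm_sub_smul_sq {κ : Type*} (s : Finset κ) (u A : κ → ℂ) {G : ℝ} {S : ℂ}
    (hG : G = ∑ k ∈ s, ‖u k‖ ^ 2) (hS : S = ∑ k ∈ s, conj (u k) * A k) (hG0 : G ≠ 0) :
    ∑ k ∈ s, ‖A k - S / G * u k‖ ^ 2 = ∑ k ∈ s, ‖A k‖ ^ 2 - ‖S‖ ^ 2 / G := by
  have h1 : ∀ k, ‖A k - S / G * u k‖ ^ 2 = ‖A k‖ ^ 2
      - 2 * (conj S / G * (conj (u k) * A k)).re + ‖S‖ ^ 2 / G ^ 2 * ‖u k‖ ^ 2 := fun k => by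
    rw [← Complex.normSq_eq_norm_sq, Complex.normSq_sub, Complex.normSq_eq_norm_sq,
      Complex.normSq_eq_norm_sq, norm_mul, norm_div, Complex.norm_real, mul_pow, div_pow,
      Real.norm_eq_abs, sq_abs]
    have : A k * conj (S / G * u k) = conj S / G * (conj (u k) * A k) := by
      simp only [map_mul, map_div₀, Complex.conj_ofReal]; ring
    rw [this]; ring
  simp only [h1, Finset.sum_add_distrib, Finset.sum_sub_distrib, ← Finset.mul_sum, ← hG,
    ← Complex.re_sum, ← hS]
  have h2 : (conj S / G * S).re = ‖S‖ ^ 2 / G := by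
    rw [div_mul_eq_mul_div, Complex.conj_mul', ← Complex.ofReal_pow, ← Complex.ofReal_div,
      Complex.ofReal_re]
  rw [h2]
  field_simp
  ring

/-- The Levi form of `log ∑ |g_k|²` for holomorphic functions `g_k`. -/
theorem leviForm_log_sum_norm_sq {κ : Type*} (s : Finset κ) {g : κ → (Fin m → ℂ) → ℂ}
    {x : Fin m → ℂ} (hg : ∀ k ∈ s, ContDiffAt ℂ 2 (g k) x) {G : ℝ}
    (hG : G = ∑ k ∈ s, ‖g k x‖ ^ 2) (hG0 : G ≠ 0) (ξ : Fin m → ℂ) {S : ℂ}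
    (hS : S = ∑ k ∈ s, conj (g k x) * fderiv ℂ (g k) x ξ) :
    leviForm (fun x => Real.log (∑ k ∈ s, ‖g k x‖ ^ 2)) x ξ
      = 4 / G * ∑ k ∈ s, ‖fderiv ℂ (g k) x ξ - S / G * g k x‖ ^ 2 := by
  have hGc := contDiffAt_sum_norm_sq hg
  have hlog : ContDiffAt ℝ 2 (fun x => Real.log (∑ k ∈ s, ‖g k x‖ ^ 2)) x :=
    hGc.log (by rw [← hG]; exact hG0)
  set A : κ → (Fin m → ℂ) → ℂ := fun k x' => fderiv ℂ (g k) x' ξ with hA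
  set B : κ → ℂ := fun k => fderiv ℂ (A k) x ξ with hB
  have hline : ∀ (c : ℂ) (t : ℝ), HasDerivAt (fun t : ℝ => x + t • c • ξ) (c • ξ) t :=
    fun c t => by
      simpa using ((hasDerivAt_id t).smul_const (c • ξ)).const_add x
  have hlim : ∀ c : ℂ, Tendsto (fun t : ℝ => x + t • c • ξ) (𝓝 0) (𝓝 x) := fun c => by
    simpa using (hline c 0).continuousAt.tendsto
  -- Only `c = 1` and `c = I` are used. The holomorphic second derivatives `B k` enter with the
  -- factor `c * c`, so they cancel between the two.
  have key : ∀ c : ℂ, iteratedFDeriv ℝ 2 (fun x => Real.log (∑ k ∈ s, ‖g k x‖ ^ 2)) x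
      ![c • ξ, c • ξ] = ((∑ k ∈ s, 2 * ((conj (g k x) * (c * c * B k)).re + ‖c * A k x‖ ^ 2)) * G
        - (2 * (c * S).re) ^ 2) / G ^ 2 := by
    intro c
    have hu : ∀ k ∈ s, ∀ᶠ t : ℝ in 𝓝 0, HasDerivAt (fun t : ℝ => g k (x + t • c • ξ))
        (c * A k (x + t • c • ξ)) t := fun k hk => by
      filter_upwards [(hlim c).eventually ((hg k hk).eventually (by simp))] with t ht
      have h := ((ht.differentiableAt (by norm_num)).hasFDerivAt.restrictScalars
        ℝ).comp_hasDerivAt t (hline c t)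
      simpa [hA, Function.comp_def] using h
    have hu2 : ∀ k ∈ s, HasDerivAt (fun t : ℝ => c * A k (x + t • c • ξ)) (c * c * B k) 0 :=
      fun k hk => by
      have h1 : DifferentiableAt ℂ (A k) x :=
        (((hg k hk).fderiv_right (m := 1) (by norm_num)).clm_apply
          contDiffAt_const).differentiableAt (by norm_num)
      have h2 : HasFDerivAt (A k) (fderiv ℂ (A k) x) (x + (0 : ℝ) • c • ξ) := by
        simpa using h1.hasFDerivAt
      have h := ((h2.restrictScalars ℝ).comp_hasDerivAt (0 : ℝ) (hline c 0)).const_mul c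
      simpa [hB, mul_assoc] using h
    have hall : ∀ᶠ t : ℝ in 𝓝 0, ∀ k ∈ s, HasDerivAt (fun t : ℝ => g k (x + t • c • ξ))
        (c * A k (x + t • c • ξ)) t := (Finset.eventually_all s).2 hu
    set g₁ : ℝ → ℝ := fun t => ∑ k ∈ s, 2 * inner ℝ (g k (x + t • c • ξ))
      (c * A k (x + t • c • ξ)) with hg₁
    have hG1 : ∀ᶠ t : ℝ in 𝓝 0, HasDerivAt (fun t : ℝ => ∑ k ∈ s, ‖g k (x + t • c • ξ)‖ ^ 2)
        (g₁ t) t := by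
      filter_upwards [hall] with t ht
      exact HasDerivAt.fun_sum fun k hk => (ht k hk).norm_sq
    have hG2 : HasDerivAt g₁ (∑ k ∈ s, 2 * ((conj (g k x) * (c * c * B k)).re
        + ‖c * A k x‖ ^ 2)) 0 := by
      refine HasDerivAt.fun_sum fun k hk => ?_
      have h := ((hall.self_of_nhds k hk).inner ℝ (hu2 k hk)).const_mul (2 : ℝ)
      rw [zero_smul, add_zero, real_inner_self_eq_norm_sq, Complex.inner,
        mul_comm (c * c * B k)] at h
      exact h
    have hne : ∀ᶠ t : ℝ in 𝓝 0, ∑ k ∈ s, ‖g k (x + t • c • ξ)‖ ^ 2 ≠ 0 :=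
      (hlim c).eventually (hGc.continuousAt.eventually_ne (by rw [← hG]; exact hG0))
    have h1 : ∀ᶠ t : ℝ in 𝓝 0,
        HasDerivAt (fun t : ℝ => Real.log (∑ k ∈ s, ‖g k (x + t • c • ξ)‖ ^ 2))
          (g₁ t / ∑ k ∈ s, ‖g k (x + t • c • ξ)‖ ^ 2) t := by
      filter_upwards [hG1, hne] with t a b using a.log b
    have h2 := hG2.fun_div hG1.self_of_nhds hne.self_of_nhds
    rw [iteratedFDeriv_two_eq_of_hasDerivAt hlog h1 h2]
    have hg10 : g₁ 0 = 2 * (c * S).re := by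
      simp only [hg₁, zero_smul, add_zero, Complex.inner, ← Finset.mul_sum, ← Complex.re_sum, hS]
      congr 2
      rw [Finset.mul_sum]
      exact Finset.sum_congr rfl fun k _ => by ring
    simp only [hg10, zero_smul, add_zero, ← hG]
    ring
  have e1 := key 1
  have e2 := key Complex.I
  rw [one_smul] at e1
  rw [leviForm, e1, e2, sum_norm_sub_smul_sq s (fun k => g k x) (fun k => A k x) hG hS hG0]
  have hsum : (∑ k ∈ s, 2 * ((conj (g k x) * (1 * 1 * B k)).re + ‖1 * A k x‖ ^ 2))
      + ∑ k ∈ s, 2 * ((conj (g k x) * (Complex.I * Complex.I * B k)).re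
        + ‖Complex.I * A k x‖ ^ 2) = 4 * ∑ k ∈ s, ‖A k x‖ ^ 2 := by
    rw [← Finset.sum_add_distrib, Finset.mul_sum]
    refine Finset.sum_congr rfl fun k _ => ?_
    rw [Complex.I_mul_I, norm_mul, norm_mul, Complex.norm_I]
    simp only [norm_one, one_mul, neg_mul, mul_neg, Complex.neg_re]
    ring
  have hSS : (2 * (1 * S).re) ^ 2 + (2 * (Complex.I * S).re) ^ 2 = 4 * ‖S‖ ^ 2 := by
    rw [← Complex.normSq_eq_norm_sq, Complex.normSq_apply]
    simp
    ring
  rw [← add_div, sub_add_sub_comm, hSS, ← add_mul, hsum]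
  field_simp

/-- The logarithm of the modulus of a nonvanishing holomorphic function is pluriharmonic. -/
theorem leviForm_log_norm_sq {g : (Fin m → ℂ) → ℂ} {x : Fin m → ℂ} (hg : ContDiffAt ℂ 2 g x)
    (h0 : g x ≠ 0) (ξ : Fin m → ℂ) : leviForm (fun x => Real.log (‖g x‖ ^ 2)) x ξ = 0 := by
  have hG0 : ‖g x‖ ^ 2 ≠ 0 := by simpa using h0
  have h := leviForm_log_sum_norm_sq {()} (g := fun _ => g) (x := x) (fun _ _ => hg)
    (G := ‖g x‖ ^ 2) (by simp) hG0 ξ rfl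
  simp only [Finset.sum_singleton] at h
  rw [h]
  have : fderiv ℂ g x ξ - conj (g x) * fderiv ℂ g x ξ / ((‖g x‖ ^ 2 : ℝ) : ℂ) * g x = 0 := by
    have h1 : ((‖g x‖ ^ 2 : ℝ) : ℂ) = conj (g x) * g x := by
      rw [Complex.conj_mul']; push_cast; rfl
    have h2 : conj (g x) ≠ 0 := by simpa using h0
    rw [h1]
    field_simp
    ring
  rw [this]
  simp

end Levi

/-! ### The residue form and its behaviour under changes of frame and under the action. -/

section Residue

open ComplexConjugate

/-- The gradient of the Brieskorn–Pham polynomial. -/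
def grad {N : ℕ} (a : Fin N → ℕ) (y : Fin N → ℂ) : Fin N → ℂ :=
  fun j => (a j : ℂ) * y j ^ (a j - 1)

theorem hasFDerivAt_poly {N : ℕ} (a : Fin N → ℕ) (y : Fin N → ℂ) :
    HasFDerivAt (poly a) (∑ j, grad a y j •
      ContinuousLinearMap.proj (R := ℂ) (φ := fun _ : Fin N => ℂ) j) y := by
  unfold poly
  refine HasFDerivAt.fun_sum fun j _ => ?_
  have h := (ContinuousLinearMap.proj (R := ℂ) (φ := fun _ : Fin N => ℂ) j).hasFDerivAt (x := y)
  exact (hasDerivAt_pow (a j) (y j)).comp_hasFDerivAt y h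

theorem fderiv_poly {N : ℕ} (a : Fin N → ℕ) (y v : Fin N → ℂ) :
    fderiv ℂ (poly a) y v = v ⬝ᵥ grad a y := by
  rw [(hasFDerivAt_poly a y).fderiv]
  simp [dotProduct, mul_comm]

theorem degree_pos {N : ℕ} {a : Fin N → ℕ} (ha : ∀ j, 2 ≤ a j) : 0 < degree a := by
  refine Nat.pos_of_ne_zero fun h => ?_
  rw [degree, Finset.lcm_eq_zero_iff] at h
  obtain ⟨j, -, hj⟩ := h
  have := ha j
  omega

theorem weight_pos {N : ℕ} {a : Fin N → ℕ} (ha : ∀ j, 2 ≤ a j) (j : Fin N) : 0 < weight a j := by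
  refine Nat.pos_of_ne_zero fun h => ?_
  have := weight_mul a j
  rw [h, zero_mul] at this
  exact (degree_pos ha).ne this

theorem grad_ne_zero {N : ℕ} {a : Fin N → ℕ} (ha : ∀ j, 2 ≤ a j) {y : Fin N → ℂ} {j : Fin N}
    (hj : y j ≠ 0) : grad a y j ≠ 0 := by
  have := ha j
  exact mul_ne_zero (by norm_cast; omega) (pow_ne_zero _ hj)

theorem grad_ne_zero_of_mem_cone {N : ℕ} {a : Fin N → ℕ} (ha : ∀ j, 2 ≤ a j) {y : Fin N → ℂ}
    (hy : y ∈ cone a) : grad a y ≠ 0 := by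
  obtain ⟨j, hj⟩ := Function.ne_iff.1 hy.2
  exact fun h => grad_ne_zero ha hj (congrFun h j)

theorem euler_dotProduct_grad {N : ℕ} {a : Fin N → ℕ} (ha : ∀ j, 2 ≤ a j) (y : Fin N → ℂ) :
    euler a y ⬝ᵥ grad a y = degree a * poly a y := by
  simp only [dotProduct, euler, grad, poly, Finset.mul_sum]
  refine Finset.sum_congr rfl fun j _ => ?_
  have := ha j
  obtain ⟨k, hk⟩ : ∃ k, a j = k + 1 := ⟨a j - 1, by omega⟩
  rw [← weight_mul a j, hk]
  push_cast
  ring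

theorem act_dotProduct_grad_act {N : ℕ} {a : Fin N → ℕ} (ha : ∀ j, 2 ≤ a j) (c : ℂ)
    (y v : Fin N → ℂ) : act a c v ⬝ᵥ grad a (act a c y) = c ^ degree a * (v ⬝ᵥ grad a y) := by
  simp only [dotProduct, act, grad, Finset.mul_sum]
  refine Finset.sum_congr rfl fun j _ => ?_
  have := ha j
  obtain ⟨k, hk⟩ : ∃ k, a j = k + 1 := ⟨a j - 1, by omega⟩
  rw [← weight_mul a j, hk, Nat.add_sub_cancel]
  ring

theorem euler_act {N : ℕ} (a : Fin N → ℕ) (c : ℂ) (y : Fin N → ℂ) :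
    euler a (act a c y) = act a c (euler a y) := by
  funext j
  simp only [euler, act]
  ring

theorem act_mem_cone {N : ℕ} {a : Fin N → ℕ} {c : ℂ} (hc : c ≠ 0) {y : Fin N → ℂ}
    (hy : y ∈ cone a) : act a c y ∈ cone a := by
  refine ⟨by rw [poly_act, hy.1, mul_zero], fun h => hy.2 ?_⟩
  funext j
  have := congrFun h j
  simpa [act, hc] using this

theorem link_subset_cone {N : ℕ} (a : Fin N → ℕ) : link a ⊆ cone a := by
  rintro z ⟨h1, h2⟩
  refine ⟨h1, ?_⟩
  rintro rfl
  simp at h2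

variable {m : ℕ}

/-- The determinant of the frame `u, e, v₁, …, v_m`, as an alternating function of `v`. -/
def frameDet (u e : Fin (m + 2) → ℂ) : (Fin (m + 2) → ℂ) [⋀^Fin m]→ₗ[ℂ] ℂ :=
  ((Matrix.detRowAlternating (R := ℂ) (n := Fin (m + 2))).curryLeft u).curryLeft e

theorem frameDet_apply (u e : Fin (m + 2) → ℂ) (v : Fin m → Fin (m + 2) → ℂ) :
    frameDet u e v = Matrix.det (Matrix.of (Fin.cons u (Fin.cons e v : Fin (m + 1) → _))) := rfl

theorem frameDet_sub_smul (u u' e : Fin (m + 2) → ℂ) (c : ℂ) (v : Fin m → Fin (m + 2) → ℂ) :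
    frameDet (u - c • u') e v = frameDet u e v - c * frameDet u' e v := by
  simp [frameDet]

/-- `g` is a nonzero kernel vector of the frame matrix. -/
theorem frameDet_eq_zero {u e g : Fin (m + 2) → ℂ} {v : Fin m → Fin (m + 2) → ℂ} (hg : g ≠ 0)
    (hu : u ⬝ᵥ g = 0) (he : e ⬝ᵥ g = 0) (hv : ∀ i, v i ⬝ᵥ g = 0) : frameDet u e v = 0 := by
  rw [frameDet_apply, ← Matrix.exists_mulVec_eq_zero_iff]
  refine ⟨g, hg, ?_⟩
  funext k
  refine Fin.cases ?_ (fun k => Fin.cases ?_ (fun k => ?_) k) k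
  · exact hu
  · exact he
  · exact hv k

theorem frameDet_ne_zero {u e : Fin (m + 2) → ℂ} {v : Fin m → Fin (m + 2) → ℂ}
    (h : LinearIndependent ℂ (Fin.cons u (Fin.cons e v : Fin (m + 1) → _) :
      Fin (m + 2) → Fin (m + 2) → ℂ)) : frameDet u e v ≠ 0 := by
  rw [frameDet_apply]
  have : LinearIndependent ℂ (Matrix.of (Fin.cons u (Fin.cons e v : Fin (m + 1) → _) :
      Fin (m + 2) → Fin (m + 2) → ℂ)).row := h
  rw [Matrix.linearIndependent_rows_iff_isUnit, Matrix.isUnit_iff_isUnit_det] at this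
  exact this.ne_zero

/-- Pulled back along the linear combinations of `v`, the form becomes a top-degree alternating form
on `ℂᵐ`, hence a multiple of the determinant. -/
theorem alternatingMap_sum_smul {M : Type*} [AddCommGroup M] [Module ℂ M]
    (f : M [⋀^Fin m]→ₗ[ℂ] ℂ) (A : Matrix (Fin m) (Fin m) ℂ) (v : Fin m → M) :
    f (fun i => ∑ k, A i k • v k) = A.det * f v := by
  have h := (f.compLinearMap (Fintype.linearCombination ℂ v)).eq_smul_basis_det
    (Pi.basisFun ℂ (Fin m))
  have h1 := DFunLike.congr_fun h (fun i => A i)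
  rw [AlternatingMap.smul_apply, Pi.basisFun_det_apply, smul_eq_mul, mul_comm] at h1
  have h2 : (fun i => Fintype.linearCombination ℂ v (Pi.basisFun ℂ (Fin m) i)) = v := by
    funext i
    simp
  change f (fun i => Fintype.linearCombination ℂ v (A i))
    = A.det * f (fun i => Fintype.linearCombination ℂ v (Pi.basisFun ℂ (Fin m) i)) at h1
  rw [h2] at h1
  exact h1

theorem frameDet_add_smul (u e : Fin (m + 2) → ℂ) (v : Fin m → Fin (m + 2) → ℂ) (c : Fin m → ℂ) :
    frameDet u e (fun i => v i + c i • e) = frameDet u e v := by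
  rw [frameDet_apply, frameDet_apply]
  refine Matrix.det_eq_of_forall_row_eq_smul_add_const
    (Fin.cons 0 (Fin.cons 0 c : Fin (m + 1) → ℂ)) 1 rfl ?_
  intro i j
  refine Fin.cases ?_ (fun i => Fin.cases ?_ (fun i => ?_) i) i
  · simp
  · simp
  · simp only [Matrix.of_apply, Fin.cons_succ]
    rfl

theorem frameDet_act (a : Fin (m + 2) → ℕ) (c : ℂ) (u e : Fin (m + 2) → ℂ)
    (v : Fin m → Fin (m + 2) → ℂ) :
    frameDet (act a c u) (act a c e) (fun i => act a c (v i))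
      = c ^ (∑ j, weight a j) * frameDet u e v := by
  rw [frameDet_apply, frameDet_apply, ← Finset.prod_pow_eq_pow_sum, ← Matrix.det_mul_row]
  congr 1
  ext i j
  refine Fin.cases ?_ (fun i => Fin.cases ?_ (fun i => ?_) i) i <;> simp [act]

/-- The residue form `(dz₀ ∧ ⋯ ∧ dz_{m+1}) / df` on the cone, contracted with the Euler field. -/
def residue (a : Fin (m + 2) → ℕ) (y : Fin (m + 2) → ℂ) (v : Fin m → Fin (m + 2) → ℂ) : ℂ :=
  frameDet (fun j => conj (grad a y j)) (euler a y) v / (∑ j, ‖grad a y j‖ ^ 2 : ℝ)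

theorem conj_dotProduct_self {N : ℕ} (g : Fin N → ℂ) :
    (fun j => conj (g j)) ⬝ᵥ g = (∑ j, ‖g j‖ ^ 2 : ℝ) := by
  simp only [dotProduct, Complex.conj_mul']
  push_cast
  rfl

theorem sum_norm_sq_pos {N : ℕ} {g : Fin N → ℂ} (hg : g ≠ 0) : 0 < ∑ j, ‖g j‖ ^ 2 := by
  obtain ⟨j, hj⟩ := Function.ne_iff.1 hg
  refine Finset.sum_pos' (fun _ _ => by positivity) ⟨j, Finset.mem_univ j, ?_⟩
  have : 0 < ‖g j‖ := norm_pos_iff.2 hj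
  positivity

theorem mem_tangentTuples_iff {a : Fin (m + 2) → ℕ} {y : Fin (m + 2) → ℂ}
    {v : Fin m → Fin (m + 2) → ℂ} :
    (y, v) ∈ tangentTuples a ↔ y ∈ cone a ∧ ∀ i, v i ⬝ᵥ grad a y = 0 := by
  simp only [tangentTuples, Set.mem_ofPred_eq, fderiv_poly]

variable {a : Fin (m + 2) → ℕ} {y : Fin (m + 2) → ℂ}
  {v : Fin m → Fin (m + 2) → ℂ}

/-- Subtracting a multiple of the conjugate gradient from `u` makes every row of the frame
orthogonal to the gradient, so the determinant sees `u` only through its pairing with the gradient.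
Hence any auxiliary vector with nonzero pairing computes the residue. -/
theorem frameDet_eq_mul_residue (ha : ∀ j, 2 ≤ a j) (h : (y, v) ∈ tangentTuples a)
    (u : Fin (m + 2) → ℂ) :
    frameDet u (euler a y) v = (u ⬝ᵥ grad a y) * residue a y v := by
  rw [mem_tangentTuples_iff] at h
  have hg := grad_ne_zero_of_mem_cone ha h.1
  have hpos : ((∑ j, ‖grad a y j‖ ^ 2 : ℝ) : ℂ) ≠ 0 := by
    exact_mod_cast (sum_norm_sq_pos hg).ne'
  have h0 := frameDet_eq_zero
    (u := u - ((u ⬝ᵥ grad a y) / (∑ j, ‖grad a y j‖ ^ 2 : ℝ)) • fun j => conj (grad a y j))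
    (e := euler a y) (v := v) hg ?_ ?_ h.2
  · rw [frameDet_sub_smul, sub_eq_zero] at h0
    rw [h0, residue]
    ring
  · rw [sub_dotProduct, smul_dotProduct, conj_dotProduct_self, smul_eq_mul, div_mul_cancel₀ _ hpos,
      sub_self]
  · rw [euler_dotProduct_grad ha, h.1.1, mul_zero]

/-- The frame determinant contributes the sum of the weights and the division by `df` removes the
degree. The comparison uses the transported conjugate gradient as auxiliary vector, since the
conjugate gradient itself is not equivariant. -/
theorem residue_act (ha : ∀ j, 2 ≤ a j) (h : (y, v) ∈ tangentTuples a) {c : ℂ} (hc : c ≠ 0) :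
    residue a (act a c y) (fun i => act a c (v i)) * c ^ degree a
      = c ^ (∑ j, weight a j) * residue a y v := by
  have h' : (act a c y, fun i => act a c (v i)) ∈ tangentTuples a := by
    rw [mem_tangentTuples_iff] at h ⊢
    exact ⟨act_mem_cone hc h.1, fun i => by rw [act_dotProduct_grad_act ha, h.2, mul_zero]⟩
  have h1 := frameDet_eq_mul_residue ha h' (act a c fun j => conj (grad a y j))
  have h2 := frameDet_eq_mul_residue ha h (fun j => conj (grad a y j))
  rw [euler_act, frameDet_act, act_dotProduct_grad_act ha, h2] at h1
  rw [mem_tangentTuples_iff] at h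
  have hg := grad_ne_zero_of_mem_cone ha h.1
  have hpos : (fun j => conj (grad a y j)) ⬝ᵥ grad a y ≠ 0 := by
    rw [conj_dotProduct_self]
    exact_mod_cast (sum_norm_sq_pos hg).ne'
  apply mul_left_cancel₀ hpos
  linear_combination -h1

theorem linearIndependent_conj_grad (ha : ∀ j, 2 ≤ a j) (h : (y, v) ∈ tangentTuples a)
    (hv : LinearIndependent ℂ (Fin.cons (euler a y) v : Fin (m + 1) → Fin (m + 2) → ℂ)) :
    LinearIndependent ℂ (Fin.cons (fun j => conj (grad a y j)) (Fin.cons (euler a y) v :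
      Fin (m + 1) → _) : Fin (m + 2) → Fin (m + 2) → ℂ) := by
  rw [mem_tangentTuples_iff] at h
  have hg := grad_ne_zero_of_mem_cone ha h.1
  refine linearIndependent_finCons.2 ⟨hv, fun hmem => ?_⟩
  have hker : Submodule.span ℂ (Set.range (Fin.cons (euler a y) v : Fin (m + 1) → _))
      ≤ LinearMap.ker ((dotProductBilin ℂ ℂ).flip (grad a y) : (Fin (m + 2) → ℂ) →ₗ[ℂ] ℂ) := by
    rw [Submodule.span_le]
    rintro _ ⟨i, rfl⟩
    refine Fin.cases ?_ (fun i => ?_) i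
    · simpa [h.1.1] using euler_dotProduct_grad ha y
    · simpa using h.2 i
  have h0 : (fun j => conj (grad a y j)) ⬝ᵥ grad a y = 0 := by simpa using hker hmem
  rw [conj_dotProduct_self] at h0
  exact (sum_norm_sq_pos hg).ne' (by exact_mod_cast h0)

theorem residue_ne_zero (ha : ∀ j, 2 ≤ a j) (h : (y, v) ∈ tangentTuples a)
    (hv : LinearIndependent ℂ (Fin.cons (euler a y) v : Fin (m + 1) → Fin (m + 2) → ℂ)) :
    residue a y v ≠ 0 := by
  have h1 := frameDet_ne_zero (linearIndependent_conj_grad ha h hv)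
  rw [frameDet_eq_mul_residue ha h] at h1
  exact right_ne_zero_of_mul h1

/-- Two frames of the quotient tangent space differ by a matrix and multiples of the Euler field. -/
theorem exists_matrix_of_tangent (ha : ∀ j, 2 ≤ a j) (h : (y, v) ∈ tangentTuples a)
    (hv : LinearIndependent ℂ (Fin.cons (euler a y) v : Fin (m + 1) → Fin (m + 2) → ℂ))
    {v' : Fin m → Fin (m + 2) → ℂ} (h' : (y, v') ∈ tangentTuples a) :
    ∃ (A : Matrix (Fin m) (Fin m) ℂ) (c : Fin m → ℂ),
      v' = fun i => (∑ k, A i k • v k) + c i • euler a y := by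
  have hli := linearIndependent_conj_grad ha h hv
  have hspan := hli.span_eq_top_of_card_eq_finrank (by simp)
  rw [mem_tangentTuples_iff] at h h'
  have hg := grad_ne_zero_of_mem_cone ha h.1
  have hex : ∀ i, ∃ (A : Fin m → ℂ) (c : ℂ), v' i = (∑ k, A k • v k) + c • euler a y := by
    intro i
    have hmem : v' i ∈ Submodule.span ℂ (Set.range (Fin.cons (fun j => conj (grad a y j))
      (Fin.cons (euler a y) v : Fin (m + 1) → _) : Fin (m + 2) → Fin (m + 2) → ℂ)) := by
      rw [hspan]; trivial
    obtain ⟨b, hb⟩ := (Submodule.mem_span_range_iff_exists_fun ℂ).1 hmem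
    rw [Fin.sum_univ_succ, Fin.sum_univ_succ] at hb
    simp only [Fin.cons_zero, Fin.cons_succ] at hb
    have h1 := congrArg (fun z => z ⬝ᵥ grad a y) hb
    simp only [add_dotProduct, smul_dotProduct, sum_dotProduct, h.2, h'.2, smul_eq_mul, mul_zero,
      Finset.sum_const_zero, euler_dotProduct_grad ha, h.1.1, add_zero, conj_dotProduct_self] at h1
    -- Pairing with the gradient kills the tangential terms, leaving only the coefficient of the
    -- conjugate gradient.
    have hb0 : b 0 = 0 := by
      refine (mul_eq_zero.1 h1).resolve_right ?_
      exact_mod_cast (sum_norm_sq_pos hg).ne'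
    refine ⟨fun k => b k.succ.succ, b (Fin.succ 0), ?_⟩
    rw [← hb, hb0, zero_smul, zero_add]
    exact add_comm _ _
  choose A c hAc using hex
  exact ⟨A, c, funext hAc⟩

theorem residue_sum_smul_add (A : Matrix (Fin m) (Fin m) ℂ) (c : Fin m → ℂ) :
    residue a y (fun i => (∑ k, A i k • v k) + c i • euler a y) = A.det * residue a y v := by
  rw [residue, residue, frameDet_add_smul, alternatingMap_sum_smul]
  ring

end Residue

/-! ### Explicit transversals, and density of points with no zero coordinate. -/

section Slice

open Topology Filter

variable {m : ℕ}

/-- With a single nonzero coordinate the polynomial reduces to one nonzero power. -/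
theorem exists_ne_zero_pair {a : Fin (m + 2) → ℕ} (ha : ∀ j, 2 ≤ a j) {y : Fin (m + 2) → ℂ}
    (hy : y ∈ cone a) : ∃ i j, y i ≠ 0 ∧ y (Fin.succAbove i j) ≠ 0 := by
  obtain ⟨i, hi⟩ := Function.ne_iff.1 hy.2
  refine ⟨i, ?_⟩
  by_contra! h
  have h0 : ∀ j, y (i.succAbove j) = 0 := fun j => h j hi
  have h1 := hy.1
  rw [poly, Fin.sum_univ_succAbove _ i] at h1
  have : ∀ j, y (i.succAbove j) ^ a (i.succAbove j) = 0 := fun j => by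
    rw [h0, zero_pow (by have := ha (i.succAbove j); omega)]
  simp only [this, Finset.sum_const_zero, add_zero] at h1
  exact hi (pow_eq_zero_iff (by have := ha i; omega) |>.1 h1)

/-- The index of the `l`-th coordinate different from `i` and `i.succAbove j`. -/
def sliceIdx (i : Fin (m + 2)) (j : Fin (m + 1)) (l : Fin m) : Fin (m + 2) :=
  i.succAbove (j.succAbove l)

theorem forall_sliceIdx {P : Fin (m + 2) → Prop} (i : Fin (m + 2)) (j : Fin (m + 1)) :
    (∀ k, P k) ↔ P i ∧ P (i.succAbove j) ∧ ∀ l, P (sliceIdx i j l) := by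
  rw [Fin.forall_iff_succAbove i, Fin.forall_iff_succAbove j]
  rfl

/-- The quotient `z_i ^ a_i / y_i ^ a_i` on the slice of the cone where `z_j = y_j`, as a function
of the remaining coordinates. -/
def sliceRatio (a : Fin (m + 2) → ℕ) (y : Fin (m + 2) → ℂ) (i : Fin (m + 2)) (j : Fin (m + 1))
    (x : Fin m → ℂ) : ℂ :=
  1 - (∑ l, (x l ^ a (sliceIdx i j l) - y (sliceIdx i j l) ^ a (sliceIdx i j l))) / y i ^ a i

/-- A local parametrization of the cone near `y` by all coordinates except the `i`-th, in which the
coordinate `i.succAbove j` is constant. -/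
def slice (a : Fin (m + 2) → ℕ) (y : Fin (m + 2) → ℂ) (i : Fin (m + 2)) (j : Fin (m + 1))
    (x : Fin m → ℂ) : Fin (m + 2) → ℂ :=
  i.insertNth (y i * sliceRatio a y i j x ^ (1 / (a i : ℂ)))
    (j.insertNth (y (i.succAbove j)) x : Fin (m + 1) → ℂ)

variable (a : Fin (m + 2) → ℕ) (y : Fin (m + 2) → ℂ) (i : Fin (m + 2)) (j : Fin (m + 1))

theorem slice_self (x : Fin m → ℂ) :
    slice a y i j x i = y i * sliceRatio a y i j x ^ (1 / (a i : ℂ)) := by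
  simp [slice]

theorem slice_succAbove (x : Fin m → ℂ) : slice a y i j x (i.succAbove j) = y (i.succAbove j) := by
  simp [slice]

theorem slice_sliceIdx (x : Fin m → ℂ) (l : Fin m) : slice a y i j x (sliceIdx i j l) = x l := by
  simp [slice, sliceIdx]

theorem sliceRatio_base : sliceRatio a y i j (fun l => y (sliceIdx i j l)) = 1 := by
  simp [sliceRatio]

theorem slice_base : slice a y i j (fun l => y (sliceIdx i j l)) = y := by
  funext k
  revert k
  rw [forall_sliceIdx i j]
  exact ⟨by simp [slice_self, sliceRatio_base], slice_succAbove .., slice_sliceIdx a y i j _⟩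

theorem differentiable_sliceRatio : Differentiable ℂ (sliceRatio a y i j) := by
  unfold sliceRatio
  fun_prop

/-- The domain of the slice parametrization. -/
def sliceDomain : Set (Fin m → ℂ) := {x | sliceRatio a y i j x ∈ Complex.slitPlane}

theorem isOpen_sliceDomain : IsOpen (sliceDomain a y i j) :=
  Complex.isOpen_slitPlane.preimage (differentiable_sliceRatio a y i j).continuous

theorem base_mem_sliceDomain : (fun l => y (sliceIdx i j l)) ∈ sliceDomain a y i j := by
  simp [sliceDomain, sliceRatio_base]

theorem differentiableOn_slice : DifferentiableOn ℂ (slice a y i j) (sliceDomain a y i j) := by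
  rw [differentiableOn_pi, forall_sliceIdx i j]
  refine ⟨?_, ?_, fun l => ?_⟩
  · simp only [slice_self]
    intro x hx
    exact (((differentiable_sliceRatio a y i j x).cpow_const (c := 1 / (a i : ℂ)) hx).const_mul
      (y i)).differentiableWithinAt
  · simp only [slice_succAbove]
    exact differentiableOn_const _
  · simp only [slice_sliceIdx]
    fun_prop

variable {a y i j}

/-- The principal root raised to the power `a i` gives back its argument everywhere, so no
slit-plane condition on `x` is needed; that condition serves differentiability only. -/
theorem poly_slice (ha : ∀ j, 2 ≤ a j) (hi : y i ≠ 0) (x : Fin m → ℂ) :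
    poly a (slice a y i j x) = poly a y := by
  have hai : a i ≠ 0 := by have := ha i; omega
  have h1 : (sliceRatio a y i j x ^ (1 / (a i : ℂ))) ^ a i = sliceRatio a y i j x := by
    rw [one_div, Complex.cpow_nat_inv_pow _ hai]
  have h2 : y i ^ a i * sliceRatio a y i j x = y i ^ a i
      - (∑ l, (x l ^ a (sliceIdx i j l) - y (sliceIdx i j l) ^ a (sliceIdx i j l))) := by
    rw [sliceRatio, mul_sub, mul_one, mul_div_cancel₀ _ (pow_ne_zero _ hi)]
  simp only [poly, Fin.sum_univ_succAbove _ i, Fin.sum_univ_succAbove _ j, slice_self,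
    slice_succAbove, mul_pow, h1, h2]
  have h3 : ∀ l, i.succAbove (j.succAbove l) = sliceIdx i j l := fun _ => rfl
  simp only [h3, slice_sliceIdx, Finset.sum_sub_distrib]
  ring

theorem slice_mem_cone (ha : ∀ j, 2 ≤ a j) (hy : y ∈ cone a) (hi : y i ≠ 0)
    (hj : y (i.succAbove j) ≠ 0) (x : Fin m → ℂ) : slice a y i j x ∈ cone a := by
  refine ⟨by rw [poly_slice ha hi, hy.1], fun h => hj ?_⟩
  rw [← slice_succAbove a y i j x, h]
  rfl

/-- The coordinate `i.succAbove j` is constant on the slice, whereas the Euler field is nonzero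
there; this kills the Euler coefficient. The free coordinates then separate the remaining vectors.
-/
theorem isTransversal_slice (ha : ∀ j, 2 ≤ a j) (hy : y ∈ cone a) (hi : y i ≠ 0)
    (hj : y (i.succAbove j) ≠ 0) : IsTransversal a (sliceDomain a y i j) (slice a y i j) := by
  refine ⟨isOpen_sliceDomain a y i j, differentiableOn_slice a y i j, fun x hx =>
    ⟨slice_mem_cone ha hy hi hj x, ?_⟩⟩
  have hd : HasFDerivAt (slice a y i j) (fderiv ℂ (slice a y i j) x) x :=
    ((differentiableOn_slice a y i j).differentiableAt
      ((isOpen_sliceDomain a y i j).mem_nhds hx)).hasFDerivAt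
  have hcoord := hasFDerivAt_pi'.1 hd
  have h1 : ∀ v, fderiv ℂ (slice a y i j) x v (i.succAbove j) = 0 := fun v => by
    have h := hcoord (i.succAbove j)
    simp only [slice_succAbove] at h
    exact DFunLike.congr_fun (h.unique (hasFDerivAt_const _ _)) v
  have h2 : ∀ v l, fderiv ℂ (slice a y i j) x v (sliceIdx i j l) = v l := fun v l => by
    have h := hcoord (sliceIdx i j l)
    simp only [slice_sliceIdx] at h
    exact DFunLike.congr_fun (h.unique (hasFDerivAt_apply l x)) v
  rw [Fintype.linearIndependent_iff]
  intro c hc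
  rw [Fin.sum_univ_succ] at hc
  simp only [Fin.cons_zero, Fin.cons_succ] at hc
  have e1 := congrFun hc (i.succAbove j)
  simp only [Pi.add_apply, Pi.smul_apply, Finset.sum_apply, h1, smul_eq_mul, mul_zero,
    Finset.sum_const_zero, add_zero, Pi.zero_apply, euler, slice_succAbove] at e1
  have hw := weight_pos ha (i.succAbove j)
  have c0 : c 0 = 0 := by
    refine (mul_eq_zero.1 e1).resolve_right (mul_ne_zero ?_ hj)
    exact_mod_cast hw.ne'
  refine Fin.cases c0 fun l => ?_
  have e2 := congrFun hc (sliceIdx i j l)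
  simpa [c0, h2, Pi.single_apply] using e2

theorem exists_isTransversal (ha : ∀ j, 2 ≤ a j) (hy : y ∈ cone a) :
    ∃ D σ x, IsTransversal a D σ ∧ x ∈ D ∧ σ x = y := by
  obtain ⟨i, j, hi, hj⟩ := exists_ne_zero_pair ha hy
  exact ⟨_, _, _, isTransversal_slice ha hy hi hj, base_mem_sliceDomain a y i j,
    slice_base a y i j⟩

/-- Points with all coordinates nonzero are dense in the cone. -/
theorem exists_forall_ne_zero_mem_nhds (ha : ∀ j, 2 ≤ a j) (hy : y ∈ cone a)
    {U : Set (Fin (m + 2) → ℂ)} (hU : U ∈ 𝓝 y) : ∃ z ∈ U, z ∈ cone a ∧ ∀ k, z k ≠ 0 := by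
  obtain ⟨i, j, hi, hj⟩ := exists_ne_zero_pair ha hy
  have hcont : ContinuousAt (slice a y i j) fun l => y (sliceIdx i j l) :=
    ((differentiableOn_slice a y i j).continuousOn).continuousAt
      ((isOpen_sliceDomain a y i j).mem_nhds (base_mem_sliceDomain a y i j))
  set x₀ : Fin m → ℂ := fun l => y (sliceIdx i j l) with hx₀
  -- All free coordinates are shifted by the same small `t > 0`: those that were zero become `t`,
  -- and the others stay nonzero near the base point.
  have hpath : Tendsto (fun t : ℝ => fun l => x₀ l + (t : ℂ)) (𝓝[>] 0) (𝓝 x₀) := by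
    have : Continuous (fun t : ℝ => fun l => x₀ l + (t : ℂ)) := by fun_prop
    have h := this.tendsto 0
    simp only [Complex.ofReal_zero, add_zero] at h
    exact h.mono_left nhdsWithin_le_nhds
  have hlim : Tendsto (fun t : ℝ => slice a y i j fun l => x₀ l + (t : ℂ)) (𝓝[>] 0) (𝓝 y) := by
    have h := hcont.tendsto
    rw [slice_base] at h
    exact h.comp hpath
  have h1 : ∀ᶠ t : ℝ in 𝓝[>] 0, ∀ l, x₀ l + (t : ℂ) ≠ 0 := by
    rw [eventually_all]
    intro l
    by_cases h0 : x₀ l = 0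
    · filter_upwards [self_mem_nhdsWithin] with t ht
      simpa [h0] using (ne_of_gt ht)
    · have : Tendsto (fun t : ℝ => x₀ l + (t : ℂ)) (𝓝[>] 0) (𝓝 (x₀ l)) :=
        (continuous_apply l).continuousAt.tendsto.comp hpath
      exact this.eventually_ne h0
  have h2 : ∀ᶠ z in 𝓝 y, z i ≠ 0 := (continuous_apply i).continuousAt.eventually_ne hi
  obtain ⟨t, ⟨htU, hti⟩, htl⟩ := ((hlim.eventually (hU : ∀ᶠ z in 𝓝 y, z ∈ U)).and
    (hlim.eventually h2) |>.and h1).exists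
  refine ⟨_, htU, slice_mem_cone ha hy hi hj _, ?_⟩
  rw [forall_sliceIdx i j]
  refine ⟨hti, ?_, fun l => ?_⟩
  · rw [slice_succAbove]; exact hj
  · rw [slice_sliceIdx]; exact htl l

end Slice

/-! ### Regularity is pairwise coprimality of the weights. -/

section Regular

open Topology Filter

theorem coe_reebFlow {N : ℕ} (a : Fin N → ℕ) (t : ℝ) (z : link a) (j : Fin N) :
    (reebFlow a t z : Fin N → ℂ) j = Complex.exp (t * Complex.I) ^ weight a j * (z : _ → ℂ) j := rfl

theorem reebFlow_add {N : ℕ} (a : Fin N → ℕ) (s t : ℝ) (z : link a) :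
    reebFlow a s (reebFlow a t z) = reebFlow a (s + t) z := by
  ext j
  simp only [coe_reebFlow, Complex.ofReal_add, add_mul, Complex.exp_add, mul_pow]
  ring

theorem reebFlow_zero {N : ℕ} (a : Fin N → ℕ) (z : link a) : reebFlow a 0 z = z := by
  ext j
  simp [coe_reebFlow]

theorem continuous_reebFlow {N : ℕ} (a : Fin N → ℕ) :
    Continuous fun q : ℝ × link a => reebFlow a q.1 q.2 := by
  refine Continuous.subtype_mk (continuous_pi fun j => ?_) _
  exact ((Complex.continuous_exp.comp ((Complex.continuous_ofReal.comp continuous_fst).mul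
    continuous_const)).pow _).mul
      ((continuous_apply j).comp (continuous_subtype_val.comp continuous_snd))

/-- A product of powers of the angular parts of two coordinates. -/
def angle {N : ℕ} (i k : Fin N) (α β : ℤ) (z : Fin N → ℂ) : ℂ :=
  (z i / ‖z i‖) ^ α * (z k / ‖z k‖) ^ β

/-- Bézout exponents give the angle weight one, so it detects the group element itself and not just
one of its powers. -/
theorem angle_act {N : ℕ} (a : Fin N → ℕ) {i k : Fin N} {α β : ℤ}
    (h : weight a i * α + weight a k * β = 1) {c : ℂ} (hc : ‖c‖ = 1) (z : Fin N → ℂ) :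
    angle i k α β (act a c z) = c * angle i k α β z := by
  have hc0 : c ≠ 0 := by
    rintro rfl
    simp at hc
  simp only [angle, act, norm_mul, norm_pow, hc, one_pow, one_mul, mul_div_assoc, mul_zpow]
  have e : (c ^ weight a i) ^ α * (c ^ weight a k) ^ β = c := by
    rw [← zpow_natCast, ← zpow_natCast, ← zpow_mul, ← zpow_mul, ← zpow_add₀ hc0, h, zpow_one]
  calc _ = ((c ^ weight a i) ^ α * (c ^ weight a k) ^ β) *
        ((z i / ‖z i‖) ^ α * (z k / ‖z k‖) ^ β) := by ring
    _ = _ := by rw [e]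

theorem angle_ne_zero {N : ℕ} {i k : Fin N} (α β : ℤ) {z : Fin N → ℂ} (hi : z i ≠ 0)
    (hk : z k ≠ 0) : angle i k α β z ≠ 0 :=
  mul_ne_zero (zpow_ne_zero _ (div_ne_zero hi (by simpa using hi)))
    (zpow_ne_zero _ (div_ne_zero hk (by simpa using hk)))

theorem norm_angle {N : ℕ} {i k : Fin N} (α β : ℤ) {z : Fin N → ℂ} (hi : z i ≠ 0)
    (hk : z k ≠ 0) : ‖angle i k α β z‖ = 1 := by
  simp [angle, norm_zpow, hi, hk]

theorem continuousOn_angle {N : ℕ} (i k : Fin N) (α β : ℤ) :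
    ContinuousOn (angle i k α β) {z | z i ≠ 0 ∧ z k ≠ 0} := by
  intro z hz
  refine ContinuousAt.continuousWithinAt ?_
  have h : ∀ (j : Fin N) (γ : ℤ), z j ≠ 0 →
      ContinuousAt (fun z : Fin N → ℂ => (z j / (‖z j‖ : ℂ)) ^ γ) z := fun j γ hj => by
    refine ContinuousAt.zpow₀ (ContinuousAt.div (continuous_apply j).continuousAt
      (Complex.continuous_ofReal.comp (continuous_apply j).norm).continuousAt (by simpa using hj)) _
      (Or.inl (div_ne_zero hj (by simpa using hj)))
  exact (h i α hz.1).mul (h k β hz.2)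

/-- The transversal is a level set of the weight-one angle, and the flow time is recovered as an
argument in `(-π, π)`, which inverts the flow box map. Two points of the level set on one orbit
differ by some `t` with `exp (t * I) = 1`, which acts trivially. -/
theorem isRegular_of_coprime {m : ℕ} {a : Fin (m + 2) → ℕ} (ha : ∀ j, 2 ≤ a j)
    (hco : ∀ i k, i ≠ k → Nat.Coprime (weight a i) (weight a k)) : IsRegular a := by
  intro p
  obtain ⟨i, j, hi, hj⟩ := exists_ne_zero_pair ha (link_subset_cone a p.2)
  set k := i.succAbove j with hk
  set α : ℤ := Nat.gcdA (weight a i) (weight a k) with hα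
  set β : ℤ := Nat.gcdB (weight a i) (weight a k) with hβ
  have hαβ : (weight a i : ℤ) * α + weight a k * β = 1 := by
    rw [← Nat.gcd_eq_gcd_ab, (hco i k (Fin.succAbove_ne i j).symm).gcd_eq_one]
    rfl
  set θ : (Fin (m + 2) → ℂ) → ℂ := angle i k α β with hθ
  have hflow : ∀ (t : ℝ) (z : link a),
      θ (reebFlow a t z : link a) = Complex.exp (t * Complex.I) * θ z := fun t z =>
    angle_act a hαβ (Complex.norm_exp_ofReal_mul_I t) z
  have hne : ∀ (t : ℝ) (z : link a) (l : Fin (m + 2)), (z : _ → ℂ) l ≠ 0 →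
      (reebFlow a t z : Fin (m + 2) → ℂ) l ≠ 0 := fun t z l hl => by
    rw [coe_reebFlow]
    exact mul_ne_zero (pow_ne_zero _ (Complex.exp_ne_zero _)) hl
  have hp0 : θ p ≠ 0 := angle_ne_zero α β hi hj
  let T : Set (link a) := {z | ((z : _ → ℂ) i ≠ 0 ∧ (z : _ → ℂ) k ≠ 0) ∧ θ z = θ p}
  let W : Set (link a) := {z | (z : _ → ℂ) i ≠ 0 ∧ (z : _ → ℂ) k ≠ 0}
  let V : Set (link a) := W ∩ (fun z : link a => θ z / θ p) ⁻¹' Complex.slitPlane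
  have hWo : IsOpen W :=
    (isOpen_ne.preimage ((continuous_apply i).comp continuous_subtype_val)).inter
      (isOpen_ne.preimage ((continuous_apply k).comp continuous_subtype_val))
  have hcont : ContinuousOn (fun z : link a => θ z / θ p) W :=
    ((continuousOn_angle i k α β).comp continuous_subtype_val.continuousOn
      (fun z hz => hz)).div_const _
  have hVo : IsOpen V := hcont.isOpen_inter_preimage hWo Complex.isOpen_slitPlane
  have harg : ∀ t ∈ Set.Ioo (-Real.pi) Real.pi, Complex.arg (Complex.exp (t * Complex.I)) = t :=
    fun t ht => by
      rw [Complex.arg_exp_mul_I]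
      exact (toIocMod_eq_self Real.two_pi_pos).2 ⟨ht.1, by linarith [ht.2]⟩
  have hfV : ∀ q : T × Set.Ioo (-Real.pi) Real.pi,
      reebFlow a (q.2 : ℝ) (q.1 : link a) ∈ V := fun q => by
    refine ⟨⟨hne _ _ _ q.1.2.1.1, hne _ _ _ q.1.2.1.2⟩, ?_⟩
    change θ _ / θ p ∈ Complex.slitPlane
    rw [hflow, q.1.2.2, mul_div_cancel_right₀ _ hp0, Complex.mem_slitPlane_iff_arg]
    rw [harg _ q.2.2]
    exact ⟨q.2.2.2.ne, Complex.exp_ne_zero _⟩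
  have hexp : ∀ z ∈ V, Complex.exp ((Complex.arg (θ z / θ p) : ℝ) * Complex.I) = θ z / θ p :=
    fun z hz => by
      have h := Complex.norm_mul_exp_arg_mul_I (θ z / θ p)
      rwa [norm_div, norm_angle α β hz.1.1 hz.1.2, norm_angle α β hi hj, div_one,
        Complex.ofReal_one, one_mul] at h
  have hgT : ∀ z : V, reebFlow a (-Complex.arg (θ z / θ p)) (z : link a) ∈ T := fun z => by
    refine ⟨⟨hne _ _ _ z.2.1.1, hne _ _ _ z.2.1.2⟩, ?_⟩
    rw [hflow, Complex.ofReal_neg, neg_mul, Complex.exp_neg, hexp z z.2, inv_div,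
      div_mul_cancel₀ _ (angle_ne_zero α β z.2.1.1 z.2.1.2)]
  have hgI : ∀ z : V, Complex.arg (θ z / θ p) ∈ Set.Ioo (-Real.pi) Real.pi := fun z =>
    ⟨Complex.neg_pi_lt_arg _, lt_of_le_of_ne (Complex.arg_le_pi _)
      (Complex.mem_slitPlane_iff_arg.1 z.2.2).1⟩
  have hargc : Continuous fun z : V => Complex.arg (θ z / θ p) := by
    rw [continuous_iff_continuousAt]
    intro z
    have h1 : ContinuousAt (fun z : link a => θ z / θ p) z.1 :=
      hcont.continuousAt (hWo.mem_nhds z.2.1)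
    have h2 : ContinuousAt (fun z : link a => Complex.arg (θ z / θ p)) z.1 :=
      ContinuousAt.comp (f := fun z : link a => θ z / θ p) (Complex.continuousAt_arg z.2.2) h1
    exact h2.comp continuous_subtype_val.continuousAt
  let e : T × Set.Ioo (-Real.pi) Real.pi ≃ₜ V :=
    { toFun := fun q => ⟨reebFlow a (q.2 : ℝ) (q.1 : link a), hfV q⟩
      invFun := fun z => (⟨_, hgT z⟩, ⟨_, hgI z⟩)
      left_inv := fun q => by
        have h : Complex.arg (θ (reebFlow a (q.2 : ℝ) (q.1 : link a) : link a) / θ p) = q.2 := by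
          rw [hflow, q.1.2.2, mul_div_cancel_right₀ _ hp0, harg _ q.2.2]
        refine Prod.ext (Subtype.ext ?_) (Subtype.ext h)
        change reebFlow a (-Complex.arg (θ (reebFlow a (q.2 : ℝ) (q.1 : link a) : link a) / θ p))
          (reebFlow a (q.2 : ℝ) (q.1 : link a)) = q.1
        rw [h, reebFlow_add, neg_add_cancel, reebFlow_zero]
      right_inv := fun z => by
        refine Subtype.ext ?_
        change reebFlow a _ (reebFlow a _ _) = _
        rw [reebFlow_add, add_neg_cancel, reebFlow_zero]
      continuous_toFun := Continuous.subtype_mk ((continuous_reebFlow a).comp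
        ((continuous_subtype_val.comp continuous_snd).prodMk
          (continuous_subtype_val.comp continuous_fst))) _
      continuous_invFun := (Continuous.subtype_mk ((continuous_reebFlow a).comp
        (hargc.neg.prodMk continuous_subtype_val)) _).prodMk (hargc.subtype_mk _) }
  refine ⟨T, Real.pi, Real.pi_pos, ⟨⟨hi, hj⟩, rfl⟩,
    hVo.isOpenEmbedding_subtypeVal.comp e.isOpenEmbedding, ?_⟩
  rintro x hx _ hy ⟨t, rfl⟩
  have h := hy.2
  rw [hflow, ← hx.2] at h
  have hc : Complex.exp (t * Complex.I) = 1 :=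
    mul_right_cancel₀ (angle_ne_zero α β hx.1.1 hx.1.2) (h.trans (one_mul _).symm)
  ext l
  rw [coe_reebFlow, hc, one_pow, one_mul]

theorem continuous_act_real {N : ℕ} (a : Fin N → ℕ) :
    Continuous fun q : ℝ × (Fin N → ℂ) => act a (q.1 : ℂ) q.2 := by
  refine continuous_pi fun j => ?_
  simp only [act]
  fun_prop

theorem norm_act_real {N : ℕ} (a : Fin N → ℕ) {r : ℝ} (hr : 0 ≤ r) (z : Fin N → ℂ) (j : Fin N) :
    ‖act a (r : ℂ) z j‖ = r ^ weight a j * ‖z j‖ := by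
  simp [act, abs_of_nonneg hr]

theorem exists_act_mem_link_of_le {N : ℕ} {a : Fin N → ℕ} {z : Fin N → ℂ} (hz : z ∈ cone a)
    {r₀ r₁ : ℝ} (h : r₀ ≤ r₁) (h0 : ∑ j, ‖act a (r₀ : ℂ) z j‖ ^ 2 ≤ 1)
    (h1 : 1 ≤ ∑ j, ‖act a (r₁ : ℂ) z j‖ ^ 2) : ∃ r ∈ Set.Icc r₀ r₁, act a (r : ℂ) z ∈ link a := by
  have hc : Continuous fun r : ℝ => ∑ j, ‖act a (r : ℂ) z j‖ ^ 2 := by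
    simp only [act]
    fun_prop
  obtain ⟨r, hr, hr1⟩ := intermediate_value_Icc h hc.continuousOn ⟨h0, h1⟩
  exact ⟨r, hr, by rw [poly_act, hz.1, mul_zero], hr1⟩

theorem exists_act_mem_link {N : ℕ} {a : Fin N → ℕ} (ha : ∀ j, 2 ≤ a j) {z : Fin N → ℂ}
    (hz : z ∈ cone a) : ∃ r : ℝ, r ≠ 0 ∧ act a (r : ℂ) z ∈ link a := by
  obtain ⟨j, hj⟩ := Function.ne_iff.1 hz.2
  have hj' : 0 < ‖z j‖ := norm_pos_iff.2 hj
  set R : ℝ := max 1 (1 / ‖z j‖) with hR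
  have hR1 : 1 ≤ R := le_max_left _ _
  have hRj : 1 ≤ R * ‖z j‖ := (div_le_iff₀ hj').1 (le_max_right _ _)
  obtain ⟨r, -, hr⟩ := exists_act_mem_link_of_le hz (r₀ := 0) (r₁ := R) (by positivity)
    (by
      have : ∀ j, ‖act a ((0 : ℝ) : ℂ) z j‖ ^ 2 = 0 := fun j => by
        rw [norm_act_real a le_rfl, zero_pow (weight_pos ha j).ne', zero_mul, zero_pow two_ne_zero]
      simp only [this, Finset.sum_const_zero]
      exact zero_le_one)
    (by
      refine le_trans ?_ (Finset.single_le_sum (f := fun j => ‖act a (R : ℂ) z j‖ ^ 2)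
        (fun _ _ => by positivity) (Finset.mem_univ j))
      have h1 : R ≤ R ^ weight a j := le_self_pow₀ hR1 (weight_pos ha j).ne'
      have h2 : 1 ≤ ‖act a (R : ℂ) z j‖ := by
        rw [norm_act_real a (by positivity)]
        exact hRj.trans (mul_le_mul_of_nonneg_right h1 hj'.le)
      exact one_le_pow₀ h2)
  refine ⟨r, ?_, hr⟩
  rintro rfl
  have h0 : act a ((0 : ℝ) : ℂ) z = 0 := by
    funext j
    simp [act, (weight_pos ha j).ne']
  rw [h0] at hr
  exact (link_subset_cone a hr).2 rfl

/-- Points with all coordinates nonzero are dense in the link. -/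
theorem exists_forall_ne_zero_mem_link {m : ℕ} {a : Fin (m + 2) → ℕ} (ha : ∀ j, 2 ≤ a j)
    {p : Fin (m + 2) → ℂ} (hp : p ∈ link a) {U : Set (Fin (m + 2) → ℂ)} (hU : U ∈ 𝓝 p) :
    ∃ z ∈ U, z ∈ link a ∧ ∀ k, z k ≠ 0 := by
  have hcont := continuous_act_real a
  have hlim : Tendsto (fun q : ℝ × (Fin (m + 2) → ℂ) => act a (q.1 : ℂ) q.2) (𝓝 1 ×ˢ 𝓝 p)
      (𝓝 p) := by
    have h := hcont.tendsto ((1 : ℝ), p)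
    have e : act a ((1 : ℝ) : ℂ) p = p := by funext j; simp [act]
    rw [nhds_prod_eq] at h
    simpa only [e] using h
  obtain ⟨S, hS, W, hW, hSW⟩ := mem_prod_iff.1 (hlim hU)
  obtain ⟨η₀, hη₀, hηS⟩ := Metric.nhds_basis_closedBall.mem_iff.1 hS
  set η : ℝ := min η₀ (1 / 2) with hη
  have hη0 : 0 < η := lt_min hη₀ (by norm_num)
  have hη1 : η ≤ 1 / 2 := min_le_right _ _
  have hΦ : ∀ r : ℝ, Continuous fun z : Fin (m + 2) → ℂ => ∑ j, ‖act a (r : ℂ) z j‖ ^ 2 :=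
    fun r => by
      simp only [act]
      fun_prop
  -- Rescaling by `1 - η` pushes `p` strictly inside the sphere and by `1 + η` strictly outside.
  -- Both persist for nearby points of the cone, which are therefore moved onto the link by a scalar
  -- close to `1`.
  have hlt : ∑ j, ‖act a ((1 - η : ℝ) : ℂ) p j‖ ^ 2 < 1 := by
    calc ∑ j, ‖act a ((1 - η : ℝ) : ℂ) p j‖ ^ 2 ≤ ∑ j, (1 - η) * ‖p j‖ ^ 2 := by
          refine Finset.sum_le_sum fun j _ => ?_
          rw [norm_act_real a (by linarith), mul_pow]
          refine mul_le_mul_of_nonneg_right ?_ (by positivity)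
          rw [← pow_mul]
          exact pow_le_of_le_one (by linarith) (by linarith)
            (mul_ne_zero (weight_pos ha j).ne' two_ne_zero)
      _ < 1 := by rw [← Finset.mul_sum, hp.2]; linarith
  have hgt : 1 < ∑ j, ‖act a ((1 + η : ℝ) : ℂ) p j‖ ^ 2 := by
    calc 1 < ∑ j, (1 + η) * ‖p j‖ ^ 2 := by rw [← Finset.mul_sum, hp.2]; linarith
      _ ≤ ∑ j, ‖act a ((1 + η : ℝ) : ℂ) p j‖ ^ 2 := by
          refine Finset.sum_le_sum fun j _ => ?_
          rw [norm_act_real a (by linarith), mul_pow]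
          refine mul_le_mul_of_nonneg_right ?_ (by positivity)
          rw [← pow_mul]
          exact le_self_pow₀ (by linarith) (mul_ne_zero (weight_pos ha j).ne' two_ne_zero)
  have hW' : ∀ᶠ z in 𝓝 p, z ∈ W ∧ ∑ j, ‖act a ((1 - η : ℝ) : ℂ) z j‖ ^ 2 < 1 ∧
      1 < ∑ j, ‖act a ((1 + η : ℝ) : ℂ) z j‖ ^ 2 := by
    filter_upwards [hW, (hΦ _).continuousAt.eventually_lt continuousAt_const hlt,
      continuousAt_const.eventually_lt (hΦ _).continuousAt hgt] with z h1 h2 h3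
      using ⟨h1, h2, h3⟩
  obtain ⟨z, ⟨hzW, hz1, hz2⟩, hzc, hz0⟩ :=
    exists_forall_ne_zero_mem_nhds ha (link_subset_cone a hp) hW'
  obtain ⟨r, hr, hrl⟩ := exists_act_mem_link_of_le hzc (by linarith) hz1.le hz2.le
  have hrS : r ∈ S := hηS (by
    rw [Metric.mem_closedBall, Real.dist_eq, abs_le]
    have := min_le_left η₀ (1 / 2)
    exact ⟨by linarith [hr.1], by linarith [hr.2]⟩)
  refine ⟨act a (r : ℂ) z, hSW (Set.mk_mem_prod hrS hzW), hrl, fun k => ?_⟩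
  have : (r : ℂ) ≠ 0 := by
    norm_cast
    linarith [hr.1]
  exact mul_ne_zero (pow_ne_zero _ this) (hz0 k)

/-- If the order of `c` divides every weight, the degree divided by that order is still a common
multiple of the exponents; minimality of the lcm forces order one. -/
theorem eq_one_of_forall_pow_weight {N : ℕ} {a : Fin N → ℕ} (ha : ∀ j, 2 ≤ a j) {c : ℂ}
    (hN : 0 < N) (h : ∀ j, c ^ weight a j = 1) : c = 1 := by
  have hd := degree_pos ha
  have hdvd : ∀ j, orderOf c ∣ weight a j := fun j => orderOf_dvd_of_pow_eq_one (h j)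
  have hod : orderOf c ∣ degree a :=
    (hdvd ⟨0, hN⟩).trans ⟨_, (weight_mul a ⟨0, hN⟩).symm⟩
  obtain ⟨q, hq⟩ := hod
  have ho : 0 < orderOf c := Nat.pos_of_ne_zero fun h0 => by simp [h0] at hq; omega
  have hq0 : 0 < q := Nat.pos_of_ne_zero fun h0 => by simp [h0] at hq; omega
  have hdq : degree a ∣ q := Finset.lcm_dvd fun j _ => by
    obtain ⟨u, hu⟩ := hdvd j
    have h1 := weight_mul a j
    rw [hq, hu, mul_assoc] at h1
    exact ⟨u, by rw [← Nat.eq_of_mul_eq_mul_left ho h1, mul_comm]⟩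
  have hle := Nat.le_of_dvd hq0 hdq
  rw [← orderOf_eq_one_iff]
  nlinarith

theorem exists_mem_link_of_pair {N : ℕ} {a : Fin N → ℕ} (ha : ∀ j, 2 ≤ a j) {i k : Fin N}
    (hik : i ≠ k) : ∃ p ∈ link a, ∀ l, l ≠ i → l ≠ k → p l = 0 := by
  have hak : 0 < a k := by have := ha k; omega
  obtain ⟨ζ, hζ⟩ := IsAlgClosed.exists_pow_nat_eq (-1 : ℂ) hak
  let y : Fin N → ℂ := fun l => if l = i then 1 else if l = k then ζ else 0
  have hy0 : ∀ l, l ≠ i → l ≠ k → y l = 0 := fun l h1 h2 => by simp [y, h1, h2]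
  have hyi : y i = 1 := by simp [y]
  have hyk : y k = ζ := by simp [y, hik.symm]
  have hy : y ∈ cone a := by
    refine ⟨?_, fun h => ?_⟩
    · rw [poly, Finset.sum_eq_add i k hik (fun l _ hl => ?_) (by simp) (by simp), hyi, hyk, hζ]
      · simp
      · rw [hy0 l hl.1 hl.2, zero_pow (by have := ha l; omega)]
    · rw [h] at hyi
      simp at hyi
  obtain ⟨r, -, hr⟩ := exists_act_mem_link ha hy
  exact ⟨_, hr, fun l h1 h2 => by simp [act, hy0 l h1 h2]⟩

/-- A common factor `g` of two weights produces a point `p` fixed at time `2π / g`. Nearby points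
with no zero coordinate come back close to themselves at that time without being fixed, so they meet
the transversal of a flow box about `p` twice. -/
theorem coprime_of_isRegular {m : ℕ} {a : Fin (m + 2) → ℕ} (ha : ∀ j, 2 ≤ a j)
    (hreg : IsRegular a) (i k : Fin (m + 2)) (hik : i ≠ k) :
    Nat.Coprime (weight a i) (weight a k) := by
  by_contra hg
  rw [Nat.Coprime] at hg
  set g := Nat.gcd (weight a i) (weight a k) with hgdef
  have hg0 : g ≠ 0 := (Nat.gcd_pos_of_pos_left _ (weight_pos ha i)).ne'
  obtain ⟨p, hp, hp0⟩ := exists_mem_link_of_pair ha hik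
  set t₀ : ℝ := 2 * Real.pi / g with ht₀
  set c₀ : ℂ := Complex.exp (t₀ * Complex.I) with hc₀
  have hprim : IsPrimitiveRoot c₀ g := by
    have := Complex.isPrimitiveRoot_exp g hg0
    convert this using 2
    rw [ht₀]
    push_cast
    ring
  have hc1 : c₀ ≠ 1 := hprim.ne_one (by omega)
  have hfix : reebFlow a t₀ ⟨p, hp⟩ = ⟨p, hp⟩ := by
    ext l
    rw [coe_reebFlow, ← hc₀]
    by_cases h1 : l = i
    · rw [h1, (hprim.pow_eq_one_iff_dvd _).2 (Nat.gcd_dvd_left _ _), one_mul]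
    by_cases h2 : l = k
    · rw [h2, (hprim.pow_eq_one_iff_dvd _).2 (Nat.gcd_dvd_right _ _), one_mul]
    · simp [hp0 l h1 h2]
  obtain ⟨T, ε, hε, hpT, hemb, hT⟩ := hreg ⟨p, hp⟩
  have hne : ∀ᶠ u : ℝ in 𝓝 0, Complex.exp (u * Complex.I) ≠ c₀ := by
    have hc : Continuous fun u : ℝ => Complex.exp (u * Complex.I) := by fun_prop
    refine hc.continuousAt.eventually_ne ?_
    simpa using hc1.symm
  obtain ⟨δ, hδ, hδne⟩ := Metric.eventually_nhds_iff.1 hne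
  -- Halving `δ` makes any difference of two flow times in `J` smaller than `δ`, too small for its
  -- exponential to equal `c₀`.
  let J : Set (T × Set.Ioo (-ε) ε) := {q | |(q.2 : ℝ)| < δ / 2}
  have hJ : IsOpen J := isOpen_lt (continuous_abs.comp (continuous_subtype_val.comp
    continuous_snd)) continuous_const
  let f : T × Set.Ioo (-ε) ε → link a := fun q => reebFlow a (q.2 : ℝ) (q.1 : link a)
  have hWo : IsOpen (f '' J) := hemb.isOpenMap _ hJ
  have hpW : (⟨p, hp⟩ : link a) ∈ f '' J :=
    ⟨(⟨_, hpT⟩, ⟨0, by simpa using hε⟩), by simpa [J] using hδ, reebFlow_zero a _⟩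
  have hct : Continuous fun z : link a => reebFlow a t₀ z :=
    (continuous_reebFlow a).comp (continuous_const.prodMk continuous_id)
  have hnhds : f '' J ∩ (fun z => reebFlow a t₀ z) ⁻¹' (f '' J) ∈ 𝓝 (⟨p, hp⟩ : link a) := by
    refine (hWo.inter (hWo.preimage hct)).mem_nhds ⟨hpW, ?_⟩
    rw [Set.mem_preimage, hfix]
    exact hpW
  obtain ⟨U, hU, hUsub⟩ := mem_nhds_subtype _ _ _ |>.1 hnhds
  obtain ⟨z, hzU, hzl, hz0⟩ := exists_forall_ne_zero_mem_link ha hp hU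
  obtain ⟨⟨⟨⟨x, hxT⟩, s, hs⟩, hsδ, hxz⟩, ⟨⟨⟨x', hxT'⟩, s', hs'⟩, hsδ', hxz'⟩⟩ :=
    hUsub (show (⟨z, hzl⟩ : link a) ∈ Subtype.val ⁻¹' U from hzU)
  change reebFlow a s x = _ at hxz
  change reebFlow a s' x' = reebFlow a t₀ _ at hxz'
  change |s| < δ / 2 at hsδ
  change |s'| < δ / 2 at hsδ'
  rw [← hxz, reebFlow_add] at hxz'
  -- Regularity enters here: `z` and its image at time `t₀` lie on one orbit, so they have the same
  -- foot in `T`.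
  have hxx : x = x' := hT x hxT x' hxT' ⟨-s' + (t₀ + s), by
    rw [← reebFlow_add, ← hxz', reebFlow_add, neg_add_cancel, reebFlow_zero]⟩
  subst hxx
  have hx0 : ∀ l, (x : Fin (m + 2) → ℂ) l ≠ 0 := fun l h => hz0 l (by
    have := congrArg (fun q : link a => (q : Fin (m + 2) → ℂ) l) hxz
    simpa [coe_reebFlow, h] using this.symm)
  have hone : Complex.exp ((t₀ + s - s' : ℝ) * Complex.I) = 1 := by
    refine eq_one_of_forall_pow_weight ha (by omega) fun l => ?_
    have h := congrArg (fun q : link a => (reebFlow a (-s') q : Fin (m + 2) → ℂ) l) hxz'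
    simp only [reebFlow_add, neg_add_cancel, reebFlow_zero, coe_reebFlow] at h
    have e : t₀ + s - s' = -s' + (t₀ + s) := by ring
    rw [e]
    exact mul_right_cancel₀ (hx0 l) (h.symm.trans (one_mul _).symm)
  refine hδne (y := s' - s) ?_ ?_
  · rw [Real.dist_eq, sub_zero]
    calc |s' - s| ≤ |s'| + |s| := abs_sub _ _
      _ < δ := by linarith
  · have e : ((t₀ + s - s' : ℝ) : ℂ) * Complex.I
        = t₀ * Complex.I - ((s' - s : ℝ) : ℂ) * Complex.I := by push_cast; ring
    rw [e, Complex.exp_sub, div_eq_one_iff_eq (Complex.exp_ne_zero _)] at hone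
    exact hone.symm

end Regular

/-! ### The residue form in a holomorphic chart. -/

section Transversal

open Topology Filter ComplexConjugate

variable {m : ℕ}

theorem contDiffAt_frameDet {𝕜 : Type*} [NontriviallyNormedField 𝕜] [NormedAlgebra 𝕜 ℂ]
    {E : Type*} [NormedAddCommGroup E] [NormedSpace 𝕜 E] {n : WithTop ℕ∞} {x : E}
    {u e : E → Fin (m + 2) → ℂ} {v : E → Fin m → Fin (m + 2) → ℂ}
    (hu : ∀ j, ContDiffAt 𝕜 n (fun x => u x j) x) (he : ∀ j, ContDiffAt 𝕜 n (fun x => e x j) x)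
    (hv : ∀ i j, ContDiffAt 𝕜 n (fun x => v x i j) x) :
    ContDiffAt 𝕜 n (fun x => frameDet (u x) (e x) (v x)) x := by
  simp only [frameDet_apply, Matrix.det_apply']
  refine ContDiffAt.sum fun s _ => contDiffAt_const.mul (contDiffAt_prod fun k _ => ?_)
  simp only [Matrix.of_apply]
  generalize s k = l
  refine Fin.cases ?_ (fun l => Fin.cases ?_ (fun l => ?_) l) l
  · simpa using hu k
  · simpa using he k
  · simpa using hv l k

theorem contDiff_grad {𝕜 : Type*} [NontriviallyNormedField 𝕜] [NormedAlgebra 𝕜 ℂ] {N : ℕ}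
    (a : Fin N → ℕ) {n : WithTop ℕ∞} (j : Fin N) : ContDiff 𝕜 n fun y => grad a y j :=
  contDiff_const.mul ((contDiff_apply 𝕜 ℂ j).pow _)

theorem contDiff_euler {𝕜 : Type*} [NontriviallyNormedField 𝕜] [NormedAlgebra 𝕜 ℂ] {N : ℕ}
    (a : Fin N → ℕ) {n : WithTop ℕ∞} (j : Fin N) : ContDiff 𝕜 n fun y => euler a y j :=
  contDiff_const.mul (contDiff_apply 𝕜 ℂ j)

/-- The coordinate frame of a parametrization. -/
def coordFrame (σ : (Fin m → ℂ) → (Fin (m + 2) → ℂ)) (x : Fin m → ℂ) :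
    Fin m → Fin (m + 2) → ℂ :=
  fun i => fderiv ℂ σ x (Pi.single i 1)

variable {a : Fin (m + 2) → ℕ} {D : Set (Fin m → ℂ)} {σ : (Fin m → ℂ) → (Fin (m + 2) → ℂ)}
  {x : Fin m → ℂ}

theorem IsTransversal.differentiableAt (h : IsTransversal a D σ) (hx : x ∈ D) :
    DifferentiableAt ℂ σ x :=
  h.2.1.differentiableAt (h.1.mem_nhds hx)

theorem IsTransversal.contDiffAt (h : IsTransversal a D σ) (hx : x ∈ D) (n : ℕ) :
    ContDiffAt ℂ n σ x :=
  (contDiffOn_nat_of_differentiableOn h.1 h.2.1 n).contDiffAt (h.1.mem_nhds hx)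

theorem IsTransversal.contDiffAt_coordFrame (h : IsTransversal a D σ) (hx : x ∈ D) (n : ℕ) :
    ContDiffAt ℂ n (coordFrame σ) x := by
  refine contDiffAt_pi.2 fun i => ?_
  have h1 := (h.contDiffAt hx (n + 1)).fderiv_right (m := (n : WithTop ℕ∞)) (by push_cast; rfl)
  exact h1.clm_apply contDiffAt_const

theorem IsTransversal.mem_tangentTuples (h : IsTransversal a D σ) (hx : x ∈ D) :
    (σ x, coordFrame σ x) ∈ tangentTuples a := by
  refine ⟨(h.2.2 x hx).1, fun i => ?_⟩
  have h1 := ((hasFDerivAt_poly a (σ x)).differentiableAt.hasFDerivAt).comp x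
    (h.differentiableAt hx).hasFDerivAt
  have h2 : poly a ∘ σ =ᶠ[𝓝 x] fun _ => 0 := by
    filter_upwards [h.1.mem_nhds hx] with x' hx' using (h.2.2 x' hx').1.1
  have h3 := (h1.congr_of_eventuallyEq h2.symm).unique (hasFDerivAt_const (0 : ℂ) x)
  exact DFunLike.congr_fun h3 (Pi.single i 1)

/-- In a chart the residue form is a nonvanishing holomorphic function. -/
theorem IsTransversal.exists_residue_eq (h : IsTransversal a D σ) (ha : ∀ j, 2 ≤ a j)
    (hx : x ∈ D) : ∃ g : (Fin m → ℂ) → ℂ, ContDiffAt ℂ 2 g x ∧ g x ≠ 0 ∧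
      ∀ᶠ x' in 𝓝 x, residue a (σ x') (coordFrame σ x') = g x' := by
  -- Freezing the conjugate gradient at the base point removes the antiholomorphic dependence; its
  -- pairing with the gradient stays nonzero nearby.
  set u : Fin (m + 2) → ℂ := fun j => conj (grad a (σ x) j) with hu
  have hσ := h.contDiffAt hx 2
  have hgrad : ContDiffAt ℂ 2 (fun x' => u ⬝ᵥ grad a (σ x')) x := by
    simp only [dotProduct]
    exact ContDiffAt.sum fun j _ =>
      contDiffAt_const.mul ((contDiff_grad a j).contDiffAt.comp x hσ)
  have hne : u ⬝ᵥ grad a (σ x) ≠ 0 := by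
    rw [hu, conj_dotProduct_self]
    exact_mod_cast (sum_norm_sq_pos (grad_ne_zero_of_mem_cone ha (h.2.2 x hx).1)).ne'
  have hev : ∀ᶠ x' in 𝓝 x, residue a (σ x') (coordFrame σ x')
      = frameDet u (euler a (σ x')) (coordFrame σ x') / (u ⬝ᵥ grad a (σ x')) := by
    filter_upwards [h.1.mem_nhds hx, hgrad.continuousAt.eventually_ne hne] with x' hx' hne'
    rw [frameDet_eq_mul_residue ha (h.mem_tangentTuples hx'), mul_div_cancel_left₀ _ hne']
  refine ⟨_, ?_, ?_, hev⟩
  · refine ContDiffAt.div (contDiffAt_frameDet (fun j => contDiffAt_const)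
      (fun j => (contDiff_euler a j).contDiffAt.comp x hσ) fun i j => ?_) hgrad hne
    exact contDiffAt_pi.1 (contDiffAt_pi.1 (h.contDiffAt_coordFrame hx 2) i) j
  · rw [← hev.self_of_nhds]
    exact residue_ne_zero ha (h.mem_tangentTuples hx) (h.2.2 x hx).2

end Transversal

/-! ### A positively curved metric when the weights are coprime with sum above the degree. -/

section Positive

open Topology Filter ComplexConjugate

variable {m : ℕ}

/-- Indices of the monomials `z_i ^ b z_j ^ c z_k` of weighted degree `2 d`. -/
def monoIdx {N : ℕ} (a : Fin N → ℕ) : Finset (Fin N × Fin N × Fin N × ℕ × ℕ) :=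
  (Finset.univ ×ˢ Finset.univ ×ˢ Finset.univ ×ˢ Finset.range (2 * degree a + 1) ×ˢ
    Finset.range (2 * degree a + 1)).filter fun q =>
      q.2.2.2.1 * weight a q.1 + q.2.2.2.2 * weight a q.2.1 + weight a q.2.2.1 = 2 * degree a

/-- The monomial `z_i ^ b z_j ^ c z_k`. -/
def mono {N : ℕ} (q : Fin N × Fin N × Fin N × ℕ × ℕ) (z : Fin N → ℂ) : ℂ :=
  z q.1 ^ q.2.2.2.1 * z q.2.1 ^ q.2.2.2.2 * z q.2.2.1

/-- The sum of the squared moduli of the monomials of `monoIdx`. -/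
def potential {N : ℕ} (a : Fin N → ℕ) (z : Fin N → ℂ) : ℝ := ∑ q ∈ monoIdx a, ‖mono q z‖ ^ 2

theorem mem_monoIdx {N : ℕ} {a : Fin N → ℕ} (ha : ∀ j, 2 ≤ a j) {i j k : Fin N} {b c : ℕ}
    (h : b * weight a i + c * weight a j + weight a k = 2 * degree a) :
    (i, j, k, b, c) ∈ monoIdx a := by
  have hi := weight_pos ha i
  have hj := weight_pos ha j
  have h1 : b ≤ b * weight a i := Nat.le_mul_of_pos_right b hi
  have h2 : c ≤ c * weight a j := Nat.le_mul_of_pos_right c hj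
  simp only [monoIdx, Finset.mem_filter, Finset.mem_product, Finset.mem_univ, Finset.mem_range,
    true_and]
  exact ⟨⟨by omega, by omega⟩, h⟩

/-- This encodes `z_i ^ (2 * a i)`; one power sits in the trailing factor. -/
theorem pure_mem_monoIdx {N : ℕ} {a : Fin N → ℕ} (ha : ∀ j, 2 ≤ a j) (i j : Fin N) :
    (i, j, i, 2 * a i - 1, 0) ∈ monoIdx a := by
  refine mem_monoIdx ha ?_
  have := ha i
  obtain ⟨k, hk⟩ : ∃ k, a i = k + 1 := ⟨a i - 1, by omega⟩
  have h1 := weight_mul a i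
  have h2 : 2 * a i - 1 = 2 * k + 1 := by omega
  rw [h2, ← h1, hk]
  ring

/-- By coprimality `w_i w_j` divides the degree, so `2d - w_k ≥ d ≥ w_i w_j` lies beyond the
Frobenius bound for `w_i` and `w_j`. The factor `2` leaves this room whatever `k` is. -/
theorem exists_mem_monoIdx {N : ℕ} {a : Fin N → ℕ} (ha : ∀ j, 2 ≤ a j) {i j : Fin N}
    (hco : Nat.Coprime (weight a i) (weight a j)) (k : Fin N) :
    ∃ b c, (i, j, k, b, c) ∈ monoIdx a := by
  have hd := degree_pos ha
  have hwij : weight a i * weight a j ≤ degree a := Nat.le_of_dvd hd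
    (hco.mul_dvd_of_dvd_of_dvd ⟨_, (weight_mul a i).symm⟩ ⟨_, (weight_mul a j).symm⟩)
  have hwk : weight a k ≤ degree a := Nat.le_of_dvd hd ⟨_, (weight_mul a k).symm⟩
  have hle : (weight a i).pred * (weight a j).pred ≤ weight a i * weight a j :=
    Nat.mul_le_mul (Nat.pred_le _) (Nat.pred_le _)
  obtain ⟨b, c, hbc⟩ := Nat.exists_add_mul_eq_of_gcd_dvd_of_mul_pred_le (weight a i) (weight a j)
    (2 * degree a - weight a k) (by rw [hco.gcd_eq_one]; exact one_dvd _) (by omega)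
  exact ⟨b, c, mem_monoIdx ha (by omega)⟩

theorem mono_act {N : ℕ} {a : Fin N → ℕ} {q : Fin N × Fin N × Fin N × ℕ × ℕ}
    (hq : q ∈ monoIdx a) (c : ℂ) (z : Fin N → ℂ) :
    mono q (act a c z) = c ^ (2 * degree a) * mono q z := by
  rw [← (Finset.mem_filter.1 hq).2]
  simp only [mono, act, pow_add, mul_pow, mul_comm _ (weight a _), pow_mul]
  ring

theorem potential_act {N : ℕ} (a : Fin N → ℕ) (c : ℂ) (z : Fin N → ℂ) :
    potential a (act a c z) = (‖c‖ ^ (2 * degree a)) ^ 2 * potential a z := by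
  simp only [potential, Finset.mul_sum]
  refine Finset.sum_congr rfl fun q hq => ?_
  rw [mono_act hq, norm_mul, norm_pow, mul_pow]

theorem potential_pos {N : ℕ} {a : Fin N → ℕ} (ha : ∀ j, 2 ≤ a j) {z : Fin N → ℂ}
    (hz : z ≠ 0) : 0 < potential a z := by
  obtain ⟨j, hj⟩ := Function.ne_iff.1 hz
  refine Finset.sum_pos' (fun _ _ => by positivity) ⟨_, pure_mem_monoIdx ha j j, ?_⟩
  have : mono (j, j, j, 2 * a j - 1, 0) z ≠ 0 := by
    exact mul_ne_zero (mul_ne_zero (pow_ne_zero _ hj) (pow_ne_zero _ hj)) hj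
  have := norm_pos_iff.2 this
  positivity

theorem contDiff_mono {𝕜 : Type*} [NontriviallyNormedField 𝕜] [NormedAlgebra 𝕜 ℂ] {N : ℕ}
    {n : WithTop ℕ∞} (q : Fin N × Fin N × Fin N × ℕ × ℕ) : ContDiff 𝕜 n (mono q) :=
  (((contDiff_apply 𝕜 ℂ _).pow _).mul ((contDiff_apply 𝕜 ℂ _).pow _)).mul (contDiff_apply 𝕜 ℂ _)

theorem contDiff_potential {N : ℕ} (a : Fin N → ℕ) {n : WithTop ℕ∞} :
    ContDiff ℝ n (potential a) :=
  ContDiff.sum fun q _ => (contDiff_mono q).norm_sq ℝ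

theorem contDiffAt_residue {a : Fin (m + 2) → ℕ} (ha : ∀ j, 2 ≤ a j) {n : WithTop ℕ∞}
    {p : (Fin (m + 2) → ℂ) × (Fin m → Fin (m + 2) → ℂ)} (hp : p.1 ∈ cone a) :
    ContDiffAt ℝ n (fun p : (Fin (m + 2) → ℂ) × (Fin m → Fin (m + 2) → ℂ) =>
      residue a p.1 p.2) p := by
  have hg : ∀ j, ContDiffAt ℝ n (fun p : (Fin (m + 2) → ℂ) × (Fin m → Fin (m + 2) → ℂ) =>
      grad a p.1 j) p := fun j => ((contDiff_grad a j).comp contDiff_fst).contDiffAt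
  simp only [residue, div_eq_mul_inv]
  refine ContDiffAt.mul (contDiffAt_frameDet (fun j => ?_) (fun j => ?_) fun i j => ?_)
    (ContDiffAt.inv ?_ ?_)
  · exact Complex.conjCLE.contDiff.contDiffAt.comp p (hg j)
  · exact ((contDiff_euler a j).comp contDiff_fst).contDiffAt
  · exact contDiffAt_pi.1 (contDiffAt_pi.1 contDiffAt_snd i) j
  · have h : ContDiffAt ℝ n (fun p : (Fin (m + 2) → ℂ) × (Fin m → Fin (m + 2) → ℂ) =>
        ∑ j, ‖grad a p.1 j‖ ^ 2) p := ContDiffAt.sum fun j _ => (hg j).norm_sq ℝ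
    exact Complex.ofRealCLM.contDiff.contDiffAt.comp p h
  · exact_mod_cast ne_of_gt (sum_norm_sq_pos (grad_ne_zero_of_mem_cone ha hp))

/-- The Hermitian metric on the anticanonical bundle given by the residue form and the potential. -/
def residueMetric (a : Fin (m + 2) → ℕ) (ha : ∀ j, 2 ≤ a j) : AnticanonicalMetric a where
  -- The exponent balances the weights: the squared residue scales by `‖c‖ ^ (2(|w| - d))` and the
  -- potential by `‖c‖ ^ (4d)`.
  normSq y v := ‖residue a y v‖ ^ 2 /
    potential a y ^ (((∑ j, weight a j : ℕ) - degree a : ℝ) / (2 * degree a))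
  smooth := fun p hp => by
    refine ContDiffAt.contDiffWithinAt (ContDiffAt.div ((contDiffAt_residue ha hp.1).norm_sq ℝ)
      (ContDiffAt.rpow_const_of_ne ((contDiff_potential a).contDiffAt.comp p contDiffAt_fst)
        (potential_pos ha hp.1.2).ne') (Real.rpow_pos_of_pos (potential_pos ha hp.1.2) _).ne')
  pos := fun y v h hv => div_pos (pow_pos (norm_pos_iff.2 (residue_ne_zero ha h hv)) 2)
    (Real.rpow_pos_of_pos (potential_pos ha h.1.2) _)
  map_det := fun y v _ A => by
    have h := residue_sum_smul_add (a := a) (y := y) (v := v) A 0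
    simp only [Pi.zero_apply, zero_smul, add_zero] at h
    rw [h, norm_mul, mul_pow, mul_div_assoc]
  add_euler := fun y v _ c => by
    have h := residue_sum_smul_add (a := a) (y := y) (v := v) 1 c
    simp only [Matrix.one_apply, ite_smul, one_smul, zero_smul, Finset.sum_ite_eq,
      Finset.mem_univ, if_true, Matrix.det_one, one_mul] at h
    rw [h]
  map_act := fun y v h c hc => by
    have hd : (0 : ℝ) < degree a := by exact_mod_cast degree_pos ha
    have hc' : 0 < ‖c‖ := norm_pos_iff.2 hc
    have h1 := congrArg norm (residue_act ha h hc)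
    rw [norm_mul, norm_mul, norm_pow, norm_pow, ← eq_div_iff (by positivity)] at h1
    have h2 : ((‖c‖ ^ (2 * degree a)) ^ 2) ^
        (((∑ j, weight a j : ℕ) - degree a : ℝ) / (2 * degree a))
        = (‖c‖ ^ (∑ j, weight a j) / ‖c‖ ^ degree a) ^ 2 := by
      rw [← pow_mul, ← Real.rpow_natCast, ← Real.rpow_mul hc'.le, ← Real.rpow_natCast ‖c‖,
        ← Real.rpow_natCast ‖c‖, ← Real.rpow_sub hc', ← Real.rpow_natCast _ 2,
        ← Real.rpow_mul hc'.le]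
      congr 1
      push_cast
      field_simp
    have hP := potential_pos ha h.1.2
    rw [h1, potential_act, Real.mul_rpow (by positivity) hP.le, h2, mul_div_right_comm, mul_pow]
    exact mul_div_mul_left _ _ (by positivity)

theorem natCast_mul_pow_pred_mul (b : ℕ) (z : ℂ) : (b : ℂ) * z ^ (b - 1) * z = b * z ^ b := by
  cases b with
  | zero => simp
  | succ b => rw [Nat.add_sub_cancel, pow_succ]; ring

theorem fderiv_mono_comp {N : ℕ} {E : Type*} [NormedAddCommGroup E] [NormedSpace ℂ E]
    {σ : E → Fin N → ℂ} {x : E} (hσ : DifferentiableAt ℂ σ x)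
    (q : Fin N × Fin N × Fin N × ℕ × ℕ) (ξ : E) :
    fderiv ℂ (fun x => mono q (σ x)) x ξ =
      (q.2.2.2.1 * σ x q.1 ^ (q.2.2.2.1 - 1) * fderiv ℂ σ x ξ q.1) * σ x q.2.1 ^ q.2.2.2.2
          * σ x q.2.2.1
        + σ x q.1 ^ q.2.2.2.1 * (q.2.2.2.2 * σ x q.2.1 ^ (q.2.2.2.2 - 1) * fderiv ℂ σ x ξ q.2.1)
          * σ x q.2.2.1
        + σ x q.1 ^ q.2.2.2.1 * σ x q.2.1 ^ q.2.2.2.2 * fderiv ℂ σ x ξ q.2.2.1 := by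
  have hc := hasFDerivAt_pi'.1 hσ.hasFDerivAt
  have h := (((hc q.1).pow q.2.2.2.1).mul ((hc q.2.1).pow q.2.2.2.2)).mul (hc q.2.2.1)
  have h' : HasFDerivAt (fun x => mono q (σ x)) _ x := h
  rw [h'.fderiv]
  simp
  ring

/-- The monomials of weighted degree `2 d` separate tangent directions modulo the Euler field. -/
theorem eq_smul_euler_of_forall_mono {N : ℕ} {a : Fin N → ℕ} (ha : ∀ j, 2 ≤ a j)
    {y η : Fin N → ℂ} {i j : Fin N} (hi : y i ≠ 0) (hj : y j ≠ 0)
    (hco : Nat.Coprime (weight a i) (weight a j)) {μ : ℂ}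
    (h : ∀ q ∈ monoIdx a,
      (q.2.2.2.1 * y q.1 ^ (q.2.2.2.1 - 1) * η q.1) * y q.2.1 ^ q.2.2.2.2 * y q.2.2.1
        + y q.1 ^ q.2.2.2.1 * (q.2.2.2.2 * y q.2.1 ^ (q.2.2.2.2 - 1) * η q.2.1) * y q.2.2.1
        + y q.1 ^ q.2.2.2.1 * y q.2.1 ^ q.2.2.2.2 * η q.2.2.1
        = 2 * degree a * μ * mono q y) : η = μ • euler a y := by
  -- Pure powers determine the components of `η` at nonzero coordinates, in particular at `i` and
  -- `j`.
  have hpure : ∀ i, y i ≠ 0 → η i = μ * weight a i * y i := fun i hi => by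
    have h1 := h _ (pure_mem_monoIdx ha i i)
    simp only [mono, pow_zero, mul_one, Nat.cast_zero, zero_mul, mul_zero, add_zero] at h1
    have h2 := natCast_mul_pow_pred_mul (2 * a i - 1) (y i)
    have hai := ha i
    obtain ⟨k, hk⟩ : ∃ k, a i = k + 1 := ⟨a i - 1, by omega⟩
    have hb : 2 * a i - 1 = 2 * k + 1 := by omega
    have hw := weight_mul a i
    rw [hb] at h1 h2
    have hd : (degree a : ℂ) = weight a i * (k + 1) := by rw [← hw, hk]; push_cast; ring
    have hk0 : (k + 1 : ℂ) ≠ 0 := by exact_mod_cast Nat.succ_ne_zero k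
    have hy := pow_ne_zero (2 * k + 1) hi
    rw [hd] at h1
    push_cast at h1 h2
    have h3 : 2 * (k + 1 : ℂ) * y i ^ (2 * k + 1) * (η i - μ * weight a i * y i) = 0 := by
      linear_combination h1 - η i * h2
    rcases mul_eq_zero.1 h3 with h4 | h4
    · exact absurd h4 (mul_ne_zero (mul_ne_zero two_ne_zero hk0) hy)
    · exact sub_eq_zero.1 h4
  funext k
  -- A monomial with trailing factor `z_k` determines `η k` even when `y k = 0`, because `y i ^ b *
  -- y j ^ c` is nonzero.
  obtain ⟨b, c, hbc⟩ := exists_mem_monoIdx ha hco k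
  have h1 := h _ hbc
  have hdeg := (Finset.mem_filter.1 hbc).2
  have hdeg' : (b : ℂ) * weight a i + c * weight a j + weight a k = 2 * degree a := by
    exact_mod_cast hdeg
  simp only [mono, hpure i hi, hpure j hj, ← hdeg'] at h1
  have e1 := natCast_mul_pow_pred_mul b (y i)
  have e2 := natCast_mul_pow_pred_mul c (y j)
  have hne := mul_ne_zero (pow_ne_zero b hi) (pow_ne_zero c hj)
  apply mul_left_cancel₀ hne
  simp only [Pi.smul_apply, euler, smul_eq_mul]
  linear_combination h1 - μ * weight a i * y j ^ c * y k * e1 - μ * weight a j * y i ^ b * y k * e2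

/-- In a chart the potential of the metric is a pluriharmonic term plus `r > 0` times the logarithm
of a sum of squared holomorphic functions. Its Levi form is a sum of squares, whose vanishing would
make a nonzero coordinate direction tangent to the orbit. -/
theorem isPositive_of_coprime {a : Fin (m + 2) → ℕ} (ha : ∀ j, 2 ≤ a j)
    (hco : ∀ i k, i ≠ k → Nat.Coprime (weight a i) (weight a k))
    (hsum : degree a < ∑ j, weight a j) : IsPositive a := by
  refine ⟨residueMetric a ha, fun D σ hσ x hx ξ hξ => ?_⟩
  obtain ⟨g, hg, hg0, hgev⟩ := hσ.exists_residue_eq ha hx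
  have hd : (0 : ℝ) < degree a := by exact_mod_cast degree_pos ha
  set r : ℝ := ((∑ j, weight a j : ℕ) - degree a : ℝ) / (2 * degree a) with hr
  have hr0 : 0 < r := by
    have : (degree a : ℝ) < (∑ j, weight a j : ℕ) := by exact_mod_cast hsum
    exact div_pos (by linarith) (by positivity)
  have hy := (hσ.2.2 x hx).1
  have hmono : ∀ q ∈ monoIdx a, ContDiffAt ℂ 2 (fun x => mono q (σ x)) x := fun q _ =>
    (contDiff_mono q).contDiffAt.comp x (hσ.contDiffAt hx 2)
  have hP0 : ∑ q ∈ monoIdx a, ‖mono q (σ x)‖ ^ 2 ≠ 0 := (potential_pos ha hy.2).ne'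
  have hev : (fun x' => -Real.log ((residueMetric a ha).normSq (σ x')
      (fun i => fderiv ℂ σ x' (Pi.single i 1)))) =ᶠ[𝓝 x] fun x' =>
      -1 * Real.log (‖g x'‖ ^ 2) + r * Real.log (∑ q ∈ monoIdx a, ‖mono q (σ x')‖ ^ 2) := by
    filter_upwards [hgev, hσ.1.mem_nhds hx, hg.continuousAt.eventually_ne hg0] with x' h1 h2 h3
    have hP : 0 < potential a (σ x') := potential_pos ha (hσ.2.2 x' h2).1.2
    change -Real.log (‖residue a (σ x') (coordFrame σ x')‖ ^ 2 / potential a (σ x') ^ r) = _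
    rw [h1, Real.log_div (by simpa using h3) (Real.rpow_pos_of_pos hP _).ne', Real.log_rpow hP,
      potential]
    ring
  have hc1 : ContDiffAt ℝ 2 (fun x' => Real.log (‖g x'‖ ^ 2)) x :=
    ((hg.restrict_scalars ℝ).norm_sq ℝ).log (by simpa using hg0)
  have hc2 : ContDiffAt ℝ 2 (fun x' => Real.log (∑ q ∈ monoIdx a, ‖mono q (σ x')‖ ^ 2)) x :=
    (contDiffAt_sum_norm_sq hmono).log hP0
  rw [leviForm_congr hev, leviForm_add (contDiffAt_const.mul hc1) (contDiffAt_const.mul hc2),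
    leviForm_const_mul hc1, leviForm_const_mul hc2, leviForm_log_norm_sq hg hg0,
    leviForm_log_sum_norm_sq (monoIdx a) hmono rfl hP0 ξ rfl, mul_zero, zero_add]
  have hPpos : 0 < ∑ q ∈ monoIdx a, ‖mono q (σ x)‖ ^ 2 := potential_pos ha hy.2
  set lam : ℂ := (∑ q ∈ monoIdx a, conj (mono q (σ x)) * fderiv ℂ (fun x => mono q (σ x)) x ξ)
    / (∑ q ∈ monoIdx a, ‖mono q (σ x)‖ ^ 2 : ℝ) with hlam
  refine mul_pos hr0 (mul_pos (by positivity) (lt_of_le_of_ne (by positivity) fun h0 => ?_))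
  -- All monomials have the same logarithmic derivative `lam`, in the sense that the derivative of
  -- each is `lam` times its value. This is the hypothesis of `eq_smul_euler_of_forall_mono`.
  have hzero := (Finset.sum_eq_zero_iff_of_nonneg (fun _ _ => by positivity)).1 h0.symm
  obtain ⟨i, j, hi, hj⟩ := exists_ne_zero_pair ha hy
  have hdC : (2 * degree a : ℂ) ≠ 0 := by exact_mod_cast (by positivity : (2 * degree a : ℝ) ≠ 0)
  have hη := eq_smul_euler_of_forall_mono ha (η := fderiv ℂ σ x ξ) hi hj
    (hco _ _ (Fin.succAbove_ne i j).symm) (μ := lam / (2 * degree a)) fun q hq => by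
      have h := hzero q hq
      rw [pow_eq_zero_iff two_ne_zero, norm_eq_zero, sub_eq_zero,
        fderiv_mono_comp (hσ.differentiableAt hx)] at h
      rw [mul_div_cancel₀ _ hdC]
      exact h
  have hξsum : ξ = ∑ i, ξ i • (Pi.single i 1 : Fin m → ℂ) := by
    ext k
    simp [Pi.single_apply]
  rw [hξsum, map_sum] at hη
  simp only [map_smul] at hη
  have hli := Fintype.linearIndependent_iff.1 (hσ.2.2 x hx).2
    (Fin.cons (-(lam / (2 * degree a))) ξ) (by
      rw [Fin.sum_univ_succ]
      simp only [Fin.cons_zero, Fin.cons_succ]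
      rw [hη, neg_smul, neg_add_cancel])
  exact hξ (funext fun k => hli k.succ)

end Positive

/-! ### A maximum principle excludes weight sums not exceeding the degree. -/

section Necessity

open Topology Filter ComplexConjugate

variable {m : ℕ} {a : Fin (m + 2) → ℕ}

theorem exists_tangent_frame (ha : ∀ j, 2 ≤ a j) {y : Fin (m + 2) → ℂ} (hy : y ∈ cone a) :
    ∃ v, (y, v) ∈ tangentTuples a ∧
      LinearIndependent ℂ (Fin.cons (euler a y) v : Fin (m + 1) → Fin (m + 2) → ℂ) := by
  obtain ⟨D, σ, x, hσ, hx, rfl⟩ := exists_isTransversal ha hy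
  exact ⟨_, hσ.mem_tangentTuples hx, (hσ.2.2 x hx).2⟩

/-- Both quantities change by the same squared determinant between frames, so their quotient depends
only on the point. -/
theorem AnticanonicalMetric.normSq_mul_residue (h : AnticanonicalMetric a) (ha : ∀ j, 2 ≤ a j)
    {y : Fin (m + 2) → ℂ} {v v' : Fin m → Fin (m + 2) → ℂ} (hv : (y, v) ∈ tangentTuples a)
    (hli : LinearIndependent ℂ (Fin.cons (euler a y) v : Fin (m + 1) → Fin (m + 2) → ℂ))
    (hv' : (y, v') ∈ tangentTuples a) :
    h.normSq y v' * ‖residue a y v‖ ^ 2 = ‖residue a y v'‖ ^ 2 * h.normSq y v := by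
  obtain ⟨A, c, rfl⟩ := exists_matrix_of_tangent ha hv hli hv'
  have hAv : (y, fun i => ∑ k, A i k • v k) ∈ tangentTuples a := by
    rw [mem_tangentTuples_iff] at hv ⊢
    refine ⟨hv.1, fun i => ?_⟩
    simp [sum_dotProduct, smul_dotProduct, hv.2]
  rw [h.add_euler y _ hAv c, h.map_det y v hv A, residue_sum_smul_add, norm_mul]
  ring

open Classical in
/-- The squared norm of the residue form, a section of a power of the tautological bundle twisted
by the canonical bundle, with respect to a metric on the anticanonical bundle. -/
def AnticanonicalMetric.ratio (h : AnticanonicalMetric a) (y : Fin (m + 2) → ℂ) : ℝ :=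
  if H : ∃ v, (y, v) ∈ tangentTuples a ∧
      LinearIndependent ℂ (Fin.cons (euler a y) v : Fin (m + 1) → Fin (m + 2) → ℂ) then
    ‖residue a y H.choose‖ ^ 2 / h.normSq y H.choose
  else 0

theorem AnticanonicalMetric.ratio_mul_normSq (h : AnticanonicalMetric a) (ha : ∀ j, 2 ≤ a j)
    {y : Fin (m + 2) → ℂ} {v : Fin m → Fin (m + 2) → ℂ} (hv : (y, v) ∈ tangentTuples a) :
    h.ratio y * h.normSq y v = ‖residue a y v‖ ^ 2 := by
  have H := exists_tangent_frame ha hv.1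
  have hpos := h.pos _ _ H.choose_spec.1 H.choose_spec.2
  rw [AnticanonicalMetric.ratio, dif_pos H, div_mul_eq_mul_div, div_eq_iff hpos.ne', mul_comm]
  exact h.normSq_mul_residue ha H.choose_spec.1 H.choose_spec.2 hv

theorem AnticanonicalMetric.ratio_pos (h : AnticanonicalMetric a) (ha : ∀ j, 2 ≤ a j)
    {y : Fin (m + 2) → ℂ} (hy : y ∈ cone a) : 0 < h.ratio y := by
  have H := exists_tangent_frame ha hy
  have hpos := h.pos _ _ H.choose_spec.1 H.choose_spec.2
  have hres := norm_pos_iff.2 (residue_ne_zero ha H.choose_spec.1 H.choose_spec.2)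
  rw [AnticanonicalMetric.ratio, dif_pos H]
  positivity

theorem AnticanonicalMetric.ratio_act (h : AnticanonicalMetric a) (ha : ∀ j, 2 ≤ a j)
    {y : Fin (m + 2) → ℂ} (hy : y ∈ cone a) {c : ℂ} (hc : c ≠ 0) :
    h.ratio (act a c y) * (‖c‖ ^ degree a) ^ 2 = (‖c‖ ^ ∑ j, weight a j) ^ 2 * h.ratio y := by
  obtain ⟨v, hv, hli⟩ := exists_tangent_frame ha hy
  have hpos := h.pos _ _ hv hli
  have h1 := h.ratio_mul_normSq ha hv
  have hcv : (act a c y, fun i => act a c (v i)) ∈ tangentTuples a := by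
    rw [mem_tangentTuples_iff] at hv ⊢
    exact ⟨act_mem_cone hc hv.1, fun i => by rw [act_dotProduct_grad_act ha, hv.2, mul_zero]⟩
  have h2 := h.ratio_mul_normSq ha hcv
  rw [h.map_act y v hv c hc] at h2
  have h3 := congrArg (fun z : ℂ => ‖z‖ ^ 2) (residue_act ha hv hc)
  simp only [norm_mul, norm_pow, mul_pow, ← h1, ← h2] at h3
  apply mul_right_cancel₀ hpos.ne'
  linear_combination h3

theorem AnticanonicalMetric.continuousOn_ratio (h : AnticanonicalMetric a)
    (ha : ∀ j, 2 ≤ a j) : ContinuousOn h.ratio (cone a) := by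
  intro y₀ hy₀
  obtain ⟨v₀, hv₀, hli⟩ := exists_tangent_frame ha hy₀
  have hpos := h.pos _ _ hv₀ hli
  -- The frame at `y₀` is projected orthogonally to the tangent spaces of nearby points, giving a
  -- continuous tangent frame in which the quotient can be computed.
  let v : (Fin (m + 2) → ℂ) → Fin m → Fin (m + 2) → ℂ := fun y l =>
    v₀ l - ((v₀ l ⬝ᵥ grad a y) / (∑ j, ‖grad a y j‖ ^ 2 : ℝ)) • fun j => conj (grad a y j)
  have hvt : ∀ y ∈ cone a, (y, v y) ∈ tangentTuples a := fun y hy => by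
    rw [mem_tangentTuples_iff]
    refine ⟨hy, fun l => ?_⟩
    have hne : ((∑ j, ‖grad a y j‖ ^ 2 : ℝ) : ℂ) ≠ 0 := by
      exact_mod_cast (sum_norm_sq_pos (grad_ne_zero_of_mem_cone ha hy)).ne'
    rw [sub_dotProduct, smul_dotProduct, conj_dotProduct_self, smul_eq_mul, div_mul_cancel₀ _ hne,
      sub_self]
  have hv0 : v y₀ = v₀ := by
    funext l
    simp only [v]
    rw [(mem_tangentTuples_iff.1 hv₀).2 l, zero_div, zero_smul, sub_zero]
  have hgc : ∀ j, Continuous fun y => grad a y j := fun j =>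
    (contDiff_grad (𝕜 := ℂ) (n := 0) a j).continuous
  have hvc : ContinuousAt v y₀ := by
    refine continuousAt_pi.2 fun l => continuousAt_pi.2 fun j => ?_
    simp only [v, Pi.sub_apply, Pi.smul_apply, smul_eq_mul]
    refine continuousAt_const.sub (ContinuousAt.mul (ContinuousAt.div ?_ ?_ ?_) ?_)
    · exact (continuous_finsetSum _ fun j _ => continuous_const.mul (hgc j)).continuousAt
    · exact (Complex.continuous_ofReal.comp
        (continuous_finsetSum _ fun j _ => (hgc j).norm.pow 2)).continuousAt
    · exact_mod_cast (sum_norm_sq_pos (grad_ne_zero_of_mem_cone ha hy₀)).ne'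
    · exact (Complex.continuous_conj.comp (hgc j)).continuousAt
  have hpair : ContinuousWithinAt (fun y => (y, v y)) (cone a) y₀ :=
    (continuousAt_id.prodMk hvc).continuousWithinAt
  have hden : ContinuousWithinAt (fun y => h.normSq y (v y)) (cone a) y₀ := by
    have h1 := h.smooth.continuousOn (y₀, v y₀) (hvt y₀ hy₀)
    exact h1.comp (f := fun y => (y, v y)) hpair hvt
  have hnum : ContinuousWithinAt (fun y => ‖residue a y (v y)‖ ^ 2) (cone a) y₀ := by
    have h1 := (contDiffAt_residue ha (n := 0) (p := (y₀, v y₀)) hy₀).continuousAt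
    have h2 := ContinuousAt.comp_continuousWithinAt (f := fun y => (y, v y)) h1 hpair
    exact h2.norm.pow 2
  have hd0 : h.normSq y₀ (v y₀) ≠ 0 := by rw [hv0]; exact hpos.ne'
  have heq : ∀ y ∈ cone a, h.normSq y (v y) ≠ 0 →
      h.ratio y = ‖residue a y (v y)‖ ^ 2 / h.normSq y (v y) := fun y hy hne => by
    rw [eq_div_iff hne, h.ratio_mul_normSq ha (hvt y hy)]
  refine (hnum.div hden hd0).congr_of_eventuallyEq ?_ (heq y₀ hy₀ hd0)
  filter_upwards [hden.eventually_ne hd0, self_mem_nhdsWithin] with y h1 h2 using heq y h2 h1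

theorem isCompact_link {N : ℕ} (a : Fin N → ℕ) : IsCompact (link a) := by
  refine Metric.isCompact_of_isClosed_isBounded ?_ ?_
  · refine IsClosed.inter (isClosed_eq ?_ continuous_const) (isClosed_eq ?_ continuous_const)
    · unfold poly; fun_prop
    · fun_prop
  · refine (Metric.isBounded_closedBall (x := 0) (r := 1)).subset fun z hz => ?_
    rw [mem_closedBall_zero_iff, pi_norm_le_iff_of_nonneg zero_le_one]
    intro j
    have h1 := Finset.single_le_sum (f := fun j => ‖z j‖ ^ 2) (fun _ _ => by positivity)
      (Finset.mem_univ j)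
    rw [hz.2] at h1
    exact (sq_le_one_iff₀ (norm_nonneg _)).1 h1

theorem IsTransversal.contDiffAt_normSq {D : Set (Fin m → ℂ)}
    {σ : (Fin m → ℂ) → (Fin (m + 2) → ℂ)} (hσ : IsTransversal a D σ)
    (h : AnticanonicalMetric a) {x : Fin m → ℂ} (hx : x ∈ D) :
    ContDiffAt ℝ 2 (fun x' => h.normSq (σ x') (coordFrame σ x')) x := by
  have h1 := (h.smooth _ (hσ.mem_tangentTuples hx)).of_le (m := 2) ENat.LEInfty.out
  have h2 : ContDiffAt ℝ 2 (fun x' => (σ x', coordFrame σ x')) x :=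
    ((hσ.contDiffAt hx 2).restrict_scalars ℝ).prodMk
      ((hσ.contDiffAt_coordFrame hx 2).restrict_scalars ℝ)
  exact (ContDiffWithinAt.comp x (f := fun x' => (σ x', coordFrame σ x')) h1 h2.contDiffWithinAt
    fun x' hx' => hσ.mem_tangentTuples hx').contDiffAt (hσ.1.mem_nhds hx)

/-- A weight-zero function on the cone built from the residue form attains its maximum. -/
theorem AnticanonicalMetric.exists_forall_le (h : AnticanonicalMetric a) (ha : ∀ j, 2 ≤ a j)
    (hsum : ∑ j, weight a j ≤ degree a) {e : ℝ}
    (he : e = 2 * ((degree a : ℝ) - (∑ j, weight a j : ℕ)) / weight a 0) :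
    ∃ y ∈ cone a, 0 < ‖y 0‖ ^ e ∧
      ∀ z ∈ cone a, ‖z 0‖ ^ e * h.ratio z ≤ ‖y 0‖ ^ e * h.ratio y := by
  have hw : (0 : ℝ) < weight a 0 := by exact_mod_cast weight_pos ha 0
  -- The exponent makes the weight of `‖z 0‖ ^ e` cancel that of `h.ratio`. It is nonnegative
  -- because `|w| ≤ d`, which gives continuity across `z 0 = 0`.
  have he0 : 0 ≤ e := by
    have : ((∑ j, weight a j : ℕ) : ℝ) ≤ degree a := by exact_mod_cast hsum
    rw [he]
    exact div_nonneg (by linarith) hw.le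
  have hcont : ContinuousOn (fun z : Fin (m + 2) → ℂ => ‖z 0‖ ^ e * h.ratio z) (link a) := by
    refine ContinuousOn.mul (Continuous.continuousOn ?_)
      ((h.continuousOn_ratio ha).mono (link_subset_cone a))
    exact (continuous_apply 0).norm.rpow_const fun _ => Or.inr he0
  obtain ⟨p₀, hp₀, -⟩ := exists_mem_link_of_pair ha (i := 0) (k := 1) (by simp)
  obtain ⟨p, -, hp, hpne⟩ := exists_forall_ne_zero_mem_link ha hp₀ univ_mem
  obtain ⟨y, hy, hmax⟩ := (isCompact_link a).exists_isMaxOn ⟨p, hp⟩ hcont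
  have hpos : 0 < ‖y 0‖ ^ e * h.ratio y := by
    refine lt_of_lt_of_le ?_ (hmax hp)
    exact mul_pos (Real.rpow_pos_of_pos (norm_pos_iff.2 (hpne 0)) _)
      (h.ratio_pos ha (link_subset_cone a hp))
  refine ⟨y, link_subset_cone a hy,
    pos_of_mul_pos_left hpos (h.ratio_pos ha (link_subset_cone a hy)).le, fun z hz => ?_⟩
  obtain ⟨r, hr, hrl⟩ := exists_act_mem_link ha hz
  have hrC : (r : ℂ) ≠ 0 := by exact_mod_cast hr
  have hn : 0 < ‖(r : ℂ)‖ := norm_pos_iff.2 hrC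
  have hscale : ‖act a (r : ℂ) z 0‖ ^ e * h.ratio (act a (r : ℂ) z) = ‖z 0‖ ^ e * h.ratio z := by
    have h1 := h.ratio_act ha hz hrC
    rw [← eq_div_iff (by positivity)] at h1
    have h2 : (‖(r : ℂ)‖ ^ weight a 0) ^ e * (‖(r : ℂ)‖ ^ ∑ j, weight a j) ^ 2
        = (‖(r : ℂ)‖ ^ degree a) ^ 2 := by
      rw [← pow_mul, ← pow_mul, ← Real.rpow_natCast, ← Real.rpow_natCast, ← Real.rpow_natCast,
        ← Real.rpow_mul hn.le, ← Real.rpow_add hn]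
      congr 1
      rw [he]
      push_cast
      field_simp
      ring
    rw [h1]
    simp only [act, norm_mul, norm_pow]
    rw [Real.mul_rpow (by positivity) (by positivity), mul_div_assoc', div_eq_iff (by positivity)]
    linear_combination ‖z 0‖ ^ e * h.ratio z * h2
  rw [← hscale]
  exact hmax hrl

/-- At a maximum of `‖z 0‖ ^ e * h.ratio z` the Levi form of its logarithm is nonpositive, yet that
form equals the curvature, the other terms being pluriharmonic. The condition `0 < m` provides a
nonzero direction. -/
theorem degree_lt_of_isPositive (hm : 0 < m) (ha : ∀ j, 2 ≤ a j) (hpos : IsPositive a) :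
    degree a < ∑ j, weight a j := by
  by_contra! hsum
  obtain ⟨h, hlevi⟩ := hpos
  obtain ⟨e, he⟩ : ∃ e : ℝ, e = 2 * ((degree a : ℝ) - (∑ j, weight a j : ℕ)) / weight a 0 :=
    ⟨_, rfl⟩
  obtain ⟨y, hy, hy0, hmax⟩ := h.exists_forall_le ha hsum he
  obtain ⟨D, σ, x, hσ, hx, rfl⟩ := exists_isTransversal ha hy
  obtain ⟨g, hg, hg0, hgev⟩ := hσ.exists_residue_eq ha hx
  -- The maximum is positive, so either `z₀` is nonzero at it, or `e = 0` and the factor is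
  -- identically `1` by the convention `0 ^ 0 = 1`.
  obtain ⟨s, hs, hs0, hsev⟩ : ∃ s : (Fin m → ℂ) → ℂ, ContDiffAt ℂ 2 s x ∧ s x ≠ 0 ∧
      ∀ᶠ x' in 𝓝 x, 0 < ‖σ x' 0‖ ^ e ∧
        Real.log (‖σ x' 0‖ ^ e) = e / 2 * Real.log (‖s x'‖ ^ 2) := by
    by_cases h0 : σ x 0 = 0
    · have he0 : e = 0 := by
        by_contra hne
        rw [h0, norm_zero, Real.zero_rpow hne] at hy0
        exact lt_irrefl _ hy0
      refine ⟨fun _ => 1, contDiffAt_const, one_ne_zero, Eventually.of_forall fun x' => ?_⟩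
      simp [he0]
    · have hc := contDiffAt_pi.1 (hσ.contDiffAt hx 2) 0
      refine ⟨fun x' => σ x' 0, hc, h0, ?_⟩
      filter_upwards [hc.continuousAt.eventually_ne h0] with x' hx'
      have hp := norm_pos_iff.2 hx'
      refine ⟨Real.rpow_pos_of_pos hp _, ?_⟩
      rw [Real.log_rpow hp, Real.log_pow]
      push_cast
      ring
  have hN0 := h.pos _ _ (hσ.mem_tangentTuples hx) (hσ.2.2 x hx).2
  have hφ : ContDiffAt ℝ 2 (fun x' => -Real.log (h.normSq (σ x') (coordFrame σ x'))) x :=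
    ((hσ.contDiffAt_normSq h hx).log hN0.ne').neg
  have hcg : ContDiffAt ℝ 2 (fun x' => Real.log (‖g x'‖ ^ 2)) x :=
    ((hg.restrict_scalars ℝ).norm_sq ℝ).log (by simpa using hg0)
  have hcs : ContDiffAt ℝ 2 (fun x' => Real.log (‖s x'‖ ^ 2)) x :=
    ((hs.restrict_scalars ℝ).norm_sq ℝ).log (by simpa using hs0)
  have hces : ContDiffAt ℝ 2 (fun x' => e / 2 * Real.log (‖s x'‖ ^ 2)) x := contDiffAt_const.mul hcs
  have hev : (fun x' => (-Real.log (h.normSq (σ x') (coordFrame σ x')) + Real.log (‖g x'‖ ^ 2))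
      + e / 2 * Real.log (‖s x'‖ ^ 2)) =ᶠ[𝓝 x]
      fun x' => Real.log (‖σ x' 0‖ ^ e * h.ratio (σ x')) := by
    filter_upwards [hgev, hsev, hσ.1.mem_nhds hx] with x' h1 h2 h3
    have hN := h.pos _ _ (hσ.mem_tangentTuples h3) (hσ.2.2 x' h3).2
    have hR := h.ratio_pos ha (hσ.2.2 x' h3).1
    have hmul := h.ratio_mul_normSq ha (hσ.mem_tangentTuples h3)
    rw [h1] at hmul
    rw [← hmul, Real.log_mul hR.ne' hN.ne', ← h2.2, Real.log_mul h2.1.ne' hR.ne']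
    ring
  have hlocmax : IsLocalMax (fun x' => (-Real.log (h.normSq (σ x') (coordFrame σ x'))
      + Real.log (‖g x'‖ ^ 2)) + e / 2 * Real.log (‖s x'‖ ^ 2)) x := by
    have hmax' : IsLocalMax (fun x' => Real.log (‖σ x' 0‖ ^ e * h.ratio (σ x'))) x := by
      filter_upwards [hsev, hσ.1.mem_nhds hx] with x' h2 h3
      exact Real.log_le_log (mul_pos h2.1 (h.ratio_pos ha (hσ.2.2 x' h3).1))
        (hmax _ (hσ.2.2 x' h3).1)
    exact hmax'.congr hev.symm
  have hξ : (fun _ => 1 : Fin m → ℂ) ≠ 0 := fun h0 => one_ne_zero (congrFun h0 ⟨0, hm⟩)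
  have hle := leviForm_nonpos_of_isLocalMax ((hφ.add hcg).add hces) hlocmax (fun _ => 1)
  rw [leviForm_add (hφ.add hcg) hces, leviForm_add hφ hcg, leviForm_const_mul hcs,
    leviForm_log_norm_sq hg hg0, leviForm_log_norm_sq hs hs0, mul_zero, add_zero, add_zero] at hle
  exact absurd (hlevi D σ hσ x hx _ hξ) (not_lt.2 hle)

end Necessity

/-! ### The arithmetic classification. -/

section Classification

theorem degree_comp_perm {N : ℕ} (a : Fin N → ℕ) (s : Equiv.Perm (Fin N)) :
    degree (a ∘ s) = degree a := by
  refine Nat.dvd_antisymm (Finset.lcm_dvd fun j _ => Finset.dvd_lcm (Finset.mem_univ (s j)))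
    (Finset.lcm_dvd fun j _ => ?_)
  have := Finset.dvd_lcm (f := a ∘ s) (Finset.mem_univ (s.symm j))
  simpa [degree] using this

theorem weight_comp_perm {N : ℕ} (a : Fin N → ℕ) (s : Equiv.Perm (Fin N)) (j : Fin N) :
    weight (a ∘ s) j = weight a (s j) := by
  rw [weight, weight, degree_comp_perm]
  rfl

theorem isRegular_and_isPositive_iff {m : ℕ} (hm : 0 < m) {a : Fin (m + 2) → ℕ}
    (ha : ∀ j, 2 ≤ a j) : (IsRegular a ∧ IsPositive a) ↔
      (∀ i k, i ≠ k → Nat.Coprime (weight a i) (weight a k)) ∧ degree a < ∑ j, weight a j :=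
  ⟨fun h => ⟨coprime_of_isRegular ha h.1, degree_lt_of_isPositive hm ha h.2⟩,
    fun h => ⟨isRegular_of_coprime ha h.1, isPositive_of_coprime ha h.1 h.2⟩⟩

theorem coprime_and_degree_lt_comp_perm {N : ℕ} (a : Fin N → ℕ) (s : Equiv.Perm (Fin N)) :
    ((∀ i k, i ≠ k → Nat.Coprime (weight (a ∘ s) i) (weight (a ∘ s) k)) ∧
        degree (a ∘ s) < ∑ j, weight (a ∘ s) j) ↔
      ((∀ i k, i ≠ k → Nat.Coprime (weight a i) (weight a k)) ∧ degree a < ∑ j, weight a j) := by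
  simp only [weight_comp_perm, degree_comp_perm, Equiv.sum_comp s (weight a)]
  refine and_congr_left fun _ => ⟨fun h i k hik => ?_, fun h i k hik => h _ _ (s.injective.ne hik)⟩
  simpa using h (s.symm i) (s.symm k) (s.symm.injective.ne hik)

theorem lt_of_coprime_of_le {u v : ℕ} (h : Nat.Coprime u v) (hle : u ≤ v) (hu : 2 ≤ u) :
    u < v := by
  refine lt_of_le_of_ne hle ?_
  rintro rfl
  rw [Nat.coprime_self] at h
  omega

/-- Pairwise coprime weights have products dividing `d`, while `d` is less than their sum; hence at
most two weights exceed `1`. Two such weights satisfy `(u₂ - 1)(u₃ - 1) < 3`, and then `d` is pinned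
down by divisibility and by all exponents being at least `2`. -/
theorem classification_four {u b : Fin 4 → ℕ} {d : ℕ} (hu : Monotone u) (hb : ∀ j, 2 ≤ b j)
    (hub : ∀ j, u j * b j = d) (hd : 0 < d) (hco : ∀ i k, i ≠ k → Nat.Coprime (u i) (u k))
    (hsum : d < ∑ j, u j) :
    b ∈ ({![2, 2, 2, 2], ![3, 3, 3, 3], ![4, 4, 4, 2], ![6, 6, 3, 2]} : Set (Fin 4 → ℕ)) := by
  rw [Fin.sum_univ_four] at hsum
  have m01 := hu (show (0 : Fin 4) ≤ 1 by decide)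
  have m12 := hu (show (1 : Fin 4) ≤ 2 by decide)
  have m23 := hu (show (2 : Fin 4) ≤ 3 by decide)
  have c12 := hco 1 2 (by decide)
  have c13 := hco 1 3 (by decide)
  have c23 := hco 2 3 (by decide)
  have e0 := hub 0
  have e1 := hub 1
  have e2 := hub 2
  have e3 := hub 3
  have b3 := hb 3
  have eta : b = ![b 0, b 1, b 2, b 3] := by
    funext j
    fin_cases j <;> rfl
  have d23 : u 2 * u 3 ∣ d := c23.mul_dvd_of_dvd_of_dvd ⟨_, e2.symm⟩ ⟨_, e3.symm⟩
  have hu0 : 0 < u 0 := Nat.pos_of_ne_zero fun h => by simp [h] at e0; omega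
  generalize b 0 = b0 at *
  generalize b 1 = b1 at *
  generalize b 2 = b2 at *
  generalize b 3 = b3' at *
  generalize u 0 = u0 at *
  generalize u 1 = u1 at *
  generalize u 2 = u2 at *
  generalize u 3 = u3 at *
  have key : u0 = 1 ∧ u1 = 1 ∧ ((u2 = 1 ∧ u3 = 1 ∧ d ≤ 3) ∨ (u2 = 1 ∧ u3 = 2 ∧ d ≤ 4) ∨
      (u2 = 2 ∧ u3 = 3 ∧ d ≤ 6)) := by
    rcases Nat.lt_or_ge u2 2 with h2 | h2
    · have : u2 = 1 := by omega
      -- From `2 * u3 ≤ d < 3 + u3`.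
      have h3 : u3 < 3 := by nlinarith
      omega
    · have l23 := lt_of_coprime_of_le c23 m23 h2
      have hle := Nat.le_of_dvd hd d23
      have h1 : u1 < 2 := by
        by_contra! h1
        have l12 := lt_of_coprime_of_le c12 m12 h1
        have d123 : u1 * (u2 * u3) ≤ d := Nat.le_of_dvd hd
          ((Nat.Coprime.mul_right c12 c13).mul_dvd_of_dvd_of_dvd ⟨_, e1.symm⟩ d23)
        nlinarith
      have h0 : u1 = 1 ∧ u0 = 1 := by omega
      have hlt : u2 * u3 < 2 + u2 + u3 := by omega
      have h2' : u2 < 3 := by nlinarith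
      have h2'' : u2 = 2 := by omega
      subst h2''
      omega
  obtain ⟨rfl, rfl, ⟨rfl, rfl, hd'⟩ | ⟨rfl, rfl, hd'⟩ | ⟨rfl, rfl, hd'⟩⟩ := key
  · obtain ⟨h0, h1, h2, h3⟩ : b0 = d ∧ b1 = d ∧ b2 = d ∧ b3' = d := by omega
    have : d = 2 ∨ d = 3 := by omega
    rw [eta, h0, h1, h2, h3]
    rcases this with h | h <;> simp [h]
  · have : b0 = 4 ∧ b1 = 4 ∧ b2 = 4 ∧ b3' = 2 := by omega
    obtain ⟨rfl, rfl, rfl, rfl⟩ := this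
    rw [eta]
    simp
  · have : b0 = 6 ∧ b1 = 6 ∧ b2 = 3 ∧ b3' = 2 := by omega
    obtain ⟨rfl, rfl, rfl, rfl⟩ := this
    rw [eta]
    simp

theorem classification_five {u b : Fin 5 → ℕ} {d : ℕ} (hu : Monotone u) (hb : ∀ j, 2 ≤ b j)
    (hub : ∀ j, u j * b j = d) (hd : 0 < d) (hco : ∀ i k, i ≠ k → Nat.Coprime (u i) (u k))
    (hsum : d < ∑ j, u j) :
    b ∈ ({![2, 2, 2, 2, 2], ![3, 3, 3, 3, 3], ![4, 4, 4, 4, 4], ![4, 4, 4, 4, 2],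
            ![6, 6, 6, 6, 2], ![6, 6, 6, 3, 2]} : Set (Fin 5 → ℕ)) := by
  rw [Fin.sum_univ_five] at hsum
  have m01 := hu (show (0 : Fin 5) ≤ 1 by decide)
  have m12 := hu (show (1 : Fin 5) ≤ 2 by decide)
  have m23 := hu (show (2 : Fin 5) ≤ 3 by decide)
  have m34 := hu (show (3 : Fin 5) ≤ 4 by decide)
  have c23 := hco 2 3 (by decide)
  have c24 := hco 2 4 (by decide)
  have c34 := hco 3 4 (by decide)
  have e0 := hub 0
  have e1 := hub 1
  have e2 := hub 2
  have e3 := hub 3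
  have e4 := hub 4
  have b4 := hb 4
  have eta : b = ![b 0, b 1, b 2, b 3, b 4] := by
    funext j
    fin_cases j <;> rfl
  have d34 : u 3 * u 4 ∣ d := c34.mul_dvd_of_dvd_of_dvd ⟨_, e3.symm⟩ ⟨_, e4.symm⟩
  have hu0 : 0 < u 0 := Nat.pos_of_ne_zero fun h => by simp [h] at e0; omega
  generalize b 0 = b0 at *
  generalize b 1 = b1 at *
  generalize b 2 = b2 at *
  generalize b 3 = b3 at *
  generalize b 4 = b4' at *
  generalize u 0 = u0 at *
  generalize u 1 = u1 at *
  generalize u 2 = u2 at *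
  generalize u 3 = u3 at *
  generalize u 4 = u4 at *
  have key : u0 = 1 ∧ u1 = 1 ∧ u2 = 1 ∧ ((u3 = 1 ∧ u4 = 1 ∧ d ≤ 4) ∨ (u3 = 1 ∧ u4 = 2 ∧ d ≤ 5) ∨
      (u3 = 1 ∧ u4 = 3 ∧ d ≤ 6) ∨ (u3 = 2 ∧ u4 = 3 ∧ d ≤ 7)) := by
    rcases Nat.lt_or_ge u3 2 with h3 | h3
    · have : u3 = 1 := by omega
      have h4 : u4 < 4 := by nlinarith
      omega
    · have l34 := lt_of_coprime_of_le c34 m34 h3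
      have hle := Nat.le_of_dvd hd d34
      have h2 : u2 < 2 := by
        by_contra! h2
        have l23 := lt_of_coprime_of_le c23 m23 h2
        have d234 : u2 * (u3 * u4) ≤ d := Nat.le_of_dvd hd
          ((Nat.Coprime.mul_right c23 c24).mul_dvd_of_dvd_of_dvd ⟨_, e2.symm⟩ d34)
        -- Three distinct weights above `1` would give `6 * u4 ≤ d`, whereas the sum of the weights
        -- is at most `5 * u4`.
        have : 6 * u4 ≤ u2 * (u3 * u4) := by
          rw [← mul_assoc]
          exact Nat.mul_le_mul_right _ (Nat.mul_le_mul h2 (by omega : 3 ≤ u3))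
        omega
      have h0 : u2 = 1 ∧ u1 = 1 ∧ u0 = 1 := by omega
      have hlt : u3 * u4 < 3 + u3 + u4 := by omega
      have h3' : u3 < 3 := by nlinarith
      have h3'' : u3 = 2 := by omega
      subst h3''
      -- The bound `(u₃ - 1)(u₄ - 1) < 4` also allows the pair `(2, 4)`, excluded only by
      -- coprimality.
      have hne : u4 ≠ 4 := by
        rintro rfl
        exact absurd c34 (by decide)
      omega
  obtain ⟨rfl, rfl, rfl, ⟨rfl, rfl, hd'⟩ | ⟨rfl, rfl, hd'⟩ | ⟨rfl, rfl, hd'⟩ | ⟨rfl, rfl, hd'⟩⟩ :=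
    key
  · obtain ⟨h0, h1, h2, h3, h4⟩ : b0 = d ∧ b1 = d ∧ b2 = d ∧ b3 = d ∧ b4' = d := by omega
    have : d = 2 ∨ d = 3 ∨ d = 4 := by omega
    rw [eta, h0, h1, h2, h3, h4]
    rcases this with h | h | h <;> simp [h]
  · have : b0 = 4 ∧ b1 = 4 ∧ b2 = 4 ∧ b3 = 4 ∧ b4' = 2 := by omega
    obtain ⟨rfl, rfl, rfl, rfl, rfl⟩ := this
    rw [eta]
    simp
  · have : b0 = 6 ∧ b1 = 6 ∧ b2 = 6 ∧ b3 = 6 ∧ b4' = 2 := by omega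
    obtain ⟨rfl, rfl, rfl, rfl, rfl⟩ := this
    rw [eta]
    simp
  · have : b0 = 6 ∧ b1 = 6 ∧ b2 = 6 ∧ b3 = 3 ∧ b4' = 2 := by omega
    obtain ⟨rfl, rfl, rfl, rfl, rfl⟩ := this
    rw [eta]
    simp

theorem coprime_and_degree_lt_of_mem_four {b : Fin 4 → ℕ}
    (hb : b ∈ ({![2, 2, 2, 2], ![3, 3, 3, 3], ![4, 4, 4, 2], ![6, 6, 3, 2]} :
      Set (Fin 4 → ℕ))) :
    (∀ i k, i ≠ k → Nat.Coprime (weight b i) (weight b k)) ∧ degree b < ∑ j, weight b j := by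
  simp only [Set.mem_insert_iff, Set.mem_singleton_iff] at hb
  rcases hb with rfl | rfl | rfl | rfl <;> decide

theorem coprime_and_degree_lt_of_mem_five {b : Fin 5 → ℕ}
    (hb : b ∈ ({![2, 2, 2, 2, 2], ![3, 3, 3, 3, 3], ![4, 4, 4, 4, 4], ![4, 4, 4, 4, 2],
            ![6, 6, 6, 6, 2], ![6, 6, 6, 3, 2]} : Set (Fin 5 → ℕ))) :
    (∀ i k, i ≠ k → Nat.Coprime (weight b i) (weight b k)) ∧ degree b < ∑ j, weight b j := by
  simp only [Set.mem_insert_iff, Set.mem_singleton_iff] at hb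
  rcases hb with rfl | rfl | rfl | rfl | rfl | rfl <;> decide

theorem isRegular_and_isPositive_iff_four (a : Fin 4 → ℕ) (ha : ∀ j, 2 ≤ a j) :
    (IsRegular a ∧ IsPositive (m := 2) a) ↔
      ∃ s : Equiv.Perm (Fin 4), a ∘ s ∈
          ({![2, 2, 2, 2], ![3, 3, 3, 3], ![4, 4, 4, 2], ![6, 6, 3, 2]} :
            Set (Fin 4 → ℕ)) := by
  rw [isRegular_and_isPositive_iff two_pos ha]
  -- Sorting by increasing weight puts the exponents in decreasing order, as in the lists.
  refine ⟨fun h => ⟨Tuple.sort (weight a), ?_⟩, fun ⟨s, hs⟩ =>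
    (coprime_and_degree_lt_comp_perm a s).1 (coprime_and_degree_lt_of_mem_four hs)⟩
  exact classification_four (u := weight a ∘ Tuple.sort (weight a)) (d := degree a)
    (Tuple.monotone_sort _) (fun j => ha _) (fun j => weight_mul a _) (degree_pos ha)
    (fun i k hik => h.1 _ _ ((Tuple.sort (weight a)).injective.ne hik))
    (h.2.trans_eq (Equiv.sum_comp (Tuple.sort (weight a)) (weight a)).symm)

theorem isRegular_and_isPositive_iff_five (a : Fin 5 → ℕ) (ha : ∀ j, 2 ≤ a j) :
    (IsRegular a ∧ IsPositive (m := 3) a) ↔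
      ∃ s : Equiv.Perm (Fin 5), a ∘ s ∈
          ({![2, 2, 2, 2, 2], ![3, 3, 3, 3, 3], ![4, 4, 4, 4, 4], ![4, 4, 4, 4, 2],
            ![6, 6, 6, 6, 2], ![6, 6, 6, 3, 2]} : Set (Fin 5 → ℕ)) := by
  rw [isRegular_and_isPositive_iff three_pos ha]
  refine ⟨fun h => ⟨Tuple.sort (weight a), ?_⟩, fun ⟨s, hs⟩ =>
    (coprime_and_degree_lt_comp_perm a s).1 (coprime_and_degree_lt_of_mem_five hs)⟩
  exact classification_five (u := weight a ∘ Tuple.sort (weight a)) (d := degree a)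
    (Tuple.monotone_sort _) (fun j => ha _) (fun j => weight_mul a _) (degree_pos ha)
    (fun i k hik => h.1 _ _ ((Tuple.sort (weight a)).injective.ne hik))
    (h.2.trans_eq (Equiv.sum_comp (Tuple.sort (weight a)) (weight a)).symm)

end Classification

end Brieskorn

end

theorem proposition3p7 :
    (∀ a : Fin 4 → ℕ, (∀ j, 2 ≤ a j) →
      ((Brieskorn.IsRegular a ∧ Brieskorn.IsPositive (m := 2) a) ↔
        ∃ s : Equiv.Perm (Fin 4), a ∘ s ∈
          ({![2, 2, 2, 2], ![3, 3, 3, 3], ![4, 4, 4, 2], ![6, 6, 3, 2]} :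
            Set (Fin 4 → ℕ)))) ∧
    (∀ a : Fin 5 → ℕ, (∀ j, 2 ≤ a j) →
      ((Brieskorn.IsRegular a ∧ Brieskorn.IsPositive (m := 3) a) ↔
        ∃ s : Equiv.Perm (Fin 5), a ∘ s ∈
          ({![2, 2, 2, 2, 2], ![3, 3, 3, 3, 3], ![4, 4, 4, 4, 4], ![4, 4, 4, 4, 2],
            ![6, 6, 6, 6, 2], ![6, 6, 6, 3, 2]} : Set (Fin 5 → ℕ)))) :=
  ⟨Brieskorn.isRegular_and_isPositive_iff_four, Brieskorn.isRegular_and_isPositive_iff_five⟩
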